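/- **Setting.** For a family of probability densities $p_\theta$ ($\theta\in\mathbb R$) on $\mathbb R$, an estimator is a sequence $\vec T=\{T_n\}$ of measurable functions $T_n:\mathbb R^n\to\mathbb R$ of $n$ i.i.d. observations. Put $$\beta(\vec T,\theta,\epsilon):=\liminf_{n\to\infty}\frac{-1}{n}\log p_\theta^n\{|T_n-\theta|\ge\epsilon\}\in[0,\infty],\qquad I^s(p\|q):=-\log\int p^s q^{1-s}\,dx .$$ For a function $g$, positive on $(0,\infty)$, with $\lim_{\epsilon\to+0}g(x\epsilon)/g(\epsilon)=x^\kappa$ for all $x>0$, let $$\alpha_1(\theta):=\limsup_{\epsilon\to+0}\frac1{g(\epsilon)}\sup_{\vec T}\ \inf_{\theta-\epsilon\le\theta'\le\theta+\epsilon}\beta(\vec T,\theta',\epsilon),\qquad \overline\alpha_1(\theta):=2^\kappa\sup_{0<s<1}I^s_{g,\theta},\qquad I^s_{g,\theta}:=\lim_{\epsilon\to+0}\frac{I^s(p_{\theta-\epsilon/2}\|p_{\theta+\epsilon/2})}{g(\epsilon)},$$ where for $\overline\alpha_1$ the last limit is required to exist and be finite, uniformly in $s\in(0,1)$. Let $\psi(x)=\frac{d}{dx}\log\Gamma(x)$.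 **Proposition.** There is exactly one $t_0\in(0,\tfrac12)$ with $$2t_0+t_0(1-t_0)\bigl(\psi(1+t_0)-\psi(1)\bigr)=1,$$ and $|t_0-0.4326|<10^{-4}$. Let $1<\kappa<2-t_0$ and $A_1>0$. Let $f$ be a probability density that vanishes outside an interval $(a,b)$, $-\infty<a<b\le\infty$, and is positive and $C^1$ on $(a,b)$, such that * as $x\to a+0$: $f(x)/(x-a)^{\kappa-1}\to A_1$ and $f'(x)^2/f(x)=O((x-a)^{\kappa-3})$; * (the coefficient $A_2$ at $b$ is zero) if $b<\infty$, then as $x\to b-0$: $f(x)/(b-x)^{\kappa-1}\to 0$ and $f'(x)^2/f(x)=o((b-x)^{\kappa-3})$; if $b=\infty$, then $f'/f$ is bounded near $+\infty$. Consider the location shift family $f_\theta(x)=f(x-\theta)$ and $g(x)=|x|^{\kappa}$ (whose index is $\kappa$). Then, for every $\theta\in\mathbb R$, the limits $I^s_{g,\theta}$ exist and are finite, uniformly in $s\in(0,1)$, and $$\alpha_1(\theta)=\overline\alpha_1(\theta)=\frac{A_1 2^{\kappa}}{\kappa}.$$ The bound is attained by the shifted minimum estimator $\underline\theta_{\epsilon,n}:=\min\{x_1,\dots,x_n\}-a-\epsilon$: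 for every $\theta\in\mathbb R$, $$\lim_{\epsilon\to+0}\frac{\beta(\vec{\underline\theta}_\epsilon,\theta,\epsilon)}{\epsilon^{\kappa}} =\lim_{\epsilon\to+0}\frac{1}{\epsilon^{\kappa}}\inf_{\theta-\epsilon\le\theta'\le\theta+\epsilon}\beta(\vec{\underline\theta}_\epsilon,\theta',\epsilon)=\frac{A_12^{\kappa}}{\kappa}.$$ -/

import Mathlib

open MeasureTheory Filter Set Topology Asymptotics

noncomputable section

namespace LargeDeviation

/-- The relative Rényi entropy `I^s(p‖q) = -log ∫ p^s q^(1-s)` of two densities on `ℝ`,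
with values in the extended reals (it is `+∞` when the integral vanishes). -/
def renyiEntropy (s : ℝ) (p q : ℝ → ℝ) : EReal :=
  -ENNReal.log (∫⁻ x, ENNReal.ofReal (p x ^ s * q x ^ (1 - s)))

/-- The measure on `ℝ` with Lebesgue density `p`. -/
def densityMeasure (p : ℝ → ℝ) : Measure ℝ :=
  volume.withDensity (fun x => ENNReal.ofReal (p x))

/-- The law `p^n` of `n` i.i.d. observations with density `p`. -/
def iidLaw (p : ℝ → ℝ) (n : ℕ) : Measure (Fin n → ℝ) :=
  Measure.pi (fun _ : Fin n => densityMeasure p)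

/-- An estimator: a sequence of measurable functions `T n` of `n` real observations. -/
structure Estimator where
  toFun : (n : ℕ) → (Fin n → ℝ) → ℝ
  measurable_toFun : ∀ n, Measurable (toFun n)

/-- The first exponential rate
`β(T, θ, ε) = liminf_n -(1/n) log p_θ^n {|T_n - θ| ≥ ε}` (possibly `+∞`)
of the estimator `T` in the family `θ ↦ p θ` of densities. -/
def expRate (p : ℝ → ℝ → ℝ) (T : Estimator) (θ ε : ℝ) : EReal :=
  liminf (fun n : ℕ =>
    -ENNReal.log (iidLaw (p θ) n {x | ε ≤ |T.toFun n x - θ|}) / (n : EReal)) atTop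

/-- `inf_{θ-ε ≤ θ' ≤ θ+ε} β(T, θ', ε)`. -/
def worstRate (p : ℝ → ℝ → ℝ) (T : Estimator) (θ ε : ℝ) : EReal :=
  ⨅ θ' ∈ Icc (θ - ε) (θ + ε), expRate p T θ' ε

/-- `α₁(θ) = limsup_{ε → +0} (1/g(ε)) sup_T inf_{θ-ε ≤ θ' ≤ θ+ε} β(T, θ', ε)`. -/
def alphaOne (p : ℝ → ℝ → ℝ) (g : ℝ → ℝ) (θ : ℝ) : EReal :=
  limsup (fun ε : ℝ => (⨆ T : Estimator, worstRate p T θ ε) / (g ε : EReal)) (𝓝[>] 0)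

/-- `I^s(p_{θ-ε/2} ‖ p_{θ+ε/2}) / g(ε)`. -/
def renyiRatio (p : ℝ → ℝ → ℝ) (g : ℝ → ℝ) (θ s ε : ℝ) : EReal :=
  renyiEntropy s (p (θ - ε / 2)) (p (θ + ε / 2)) / (g ε : EReal)

/-- `I^s_{g,θ} = lim_{ε → +0} I^s(p_{θ-ε/2} ‖ p_{θ+ε/2}) / g(ε)`. -/
def renyiRate (p : ℝ → ℝ → ℝ) (g : ℝ → ℝ) (θ s : ℝ) : EReal :=
  limUnder (𝓝[>] (0 : ℝ)) (renyiRatio p g θ s)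

/-- The limit defining `I^s_{g,θ}` exists as a finite number for every `0 < s < 1`,
uniformly in `s`. -/
def UniformRenyiLimit (p : ℝ → ℝ → ℝ) (g : ℝ → ℝ) (θ : ℝ) : Prop :=
  ∃ I : ℝ → ℝ, ∀ η : ℝ, 0 < η → ∀ᶠ ε in 𝓝[>] (0 : ℝ), ∀ s ∈ Ioo (0 : ℝ) 1,
    ((I s - η : ℝ) : EReal) ≤ renyiRatio p g θ s ε ∧
      renyiRatio p g θ s ε ≤ ((I s + η : ℝ) : EReal)

/-- `κ` is the index of `g` at `+0`: `lim_{ε → +0} g(xε)/g(ε) = x^κ` for all `x > 0`. -/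
def HasIndex (g : ℝ → ℝ) (κ : ℝ) : Prop :=
  ∀ x : ℝ, 0 < x → Tendsto (fun ε => g (x * ε) / g ε) (𝓝[>] 0) (𝓝 (x ^ κ))

/-- `ᾱ₁(θ) = 2^κ sup_{0<s<1} I^s_{g,θ}`, where `κ` is the index of `g`. -/
def alphaOneBar (p : ℝ → ℝ → ℝ) (g : ℝ → ℝ) (κ θ : ℝ) : EReal :=
  (((2 : ℝ) ^ κ : ℝ) : EReal) * ⨆ s ∈ Ioo (0 : ℝ) 1, renyiRate p g θ s

/-- The location shift family `f_θ(x) = f(x - θ)`. -/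
def shiftFamily (f : ℝ → ℝ) : ℝ → ℝ → ℝ := fun θ x => f (x - θ)

/-- The shifted minimum estimator `min(x_1, …, x_n) - a - ε`. -/
def shiftedMin (a ε : ℝ) : Estimator where
  toFun n x := (⨅ i : Fin n, x i) - a - ε
  measurable_toFun _n :=
    ((Measurable.iInf fun i => measurable_pi_apply i).sub_const a).sub_const ε

/-- The digamma function `ψ(x) = (d/dx) log Γ(x)`. -/
def psi (x : ℝ) : ℝ := deriv (fun y => Real.log (Real.Gamma y)) x

/-- `f` is a probability density whose support is the interval `(a, b)`, where `b` is a real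
number or `+∞`, and which is `C¹` and positive there. -/
structure IsIntervalDensity (f : ℝ → ℝ) (a : ℝ) (b : EReal) : Prop where
  pos : ∀ x : ℝ, a < x → (x : EReal) < b → 0 < f x
  eq_zero : ∀ x : ℝ, ¬(a < x ∧ (x : EReal) < b) → f x = 0
  contDiffOn : ContDiffOn ℝ 1 f {x : ℝ | a < x ∧ (x : EReal) < b}
  lintegral_eq_one : ∫⁻ x, ENNReal.ofReal (f x) = 1

/-- Left endpoint: `f(x) ≅ A (x-a)^(κ-1)` as `x → a+0`, with the control of the derivative
`f'² / f = O((x-a)^(κ-3))` (that is, `f'(x) = O((x-a)^(κ-2))`). -/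
structure LeftEndpoint (f : ℝ → ℝ) (a κ A : ℝ) : Prop where
  tendsto : Tendsto (fun x => f x / (x - a) ^ (κ - 1)) (𝓝[>] a) (𝓝 A)
  deriv_isBigO :
    (fun x => deriv f x ^ 2 / f x) =O[𝓝[>] a] (fun x => (x - a) ^ (κ - 3))

/-- Right endpoint with vanishing coefficient `A₂ = 0`. If `b` is finite:
`f(x) = o((b-x)^(κ-1))` and `f'² / f = o((b-x)^(κ-3))` as `x → b-0`.
If `b = +∞`: the logarithmic derivative `f'/f` stays bounded as `x → ∞`. -/
structure NegligibleRightEndpoint (f : ℝ → ℝ) (b : EReal) (κ : ℝ) : Prop where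
  finite_tendsto : ∀ r : ℝ, b = r →
    Tendsto (fun x => f x / (r - x) ^ (κ - 1)) (𝓝[<] r) (𝓝 0)
  finite_deriv_isLittleO : ∀ r : ℝ, b = r →
    (fun x => deriv f x ^ 2 / f x) =o[𝓝[<] r] (fun x => (r - x) ^ (κ - 3))
  infinite_deriv_isBigO : b = ⊤ → deriv f =O[atTop] f

end LargeDeviation

end

open LargeDeviation

/-! Put α = κ - 1 and compare f(x + ε) with f(x). The deficit 1 - ∫ f(x + ε)^s f(x)^(1-s) is the
integral of the weighted AM-GM gap `amgmGap`, which is at most (√f(x + ε) - √f(x))² whatever s is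
(`amgmGap_le_sq_sqrt_sub`). Since κ < 2, this Hellinger bound makes everything away from a
negligible against ε^κ: the interior contributes O(ε²), and the conditions at b handle the rest.
Near a, the substitution x = a + εu and dominated convergence replace f by A₁ u₊^α, so the deficit
is A₁ ε^κ `powerRate` α s + o(ε^κ), uniformly in s (`tendsto_integral_amgmGap`). Taking -log changes
it only to second order, so the Rényi rates are A₁ `powerRate` α s.

The rate has two parts. Where only the left translate lives, -1 < u ≤ 0, the gap contributes exactly
s/κ. Where u > 0, convexity of exp bounds the contribution by (1 - s) K, with K the unnormalized
Kullback-Leibler integral of (u + 1)^α relative to u^α. Expanding the logarithm evaluates K through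
the digamma function (`integral_klKernel`), and K ≤ 1/κ is equivalent to `thresholdFun` (2 - κ) ≥ 1,
which κ < 2 - t₀ guarantees. Hence s/κ ≤ `powerRate` α s ≤ 1/κ, and the supremum 1/κ is approached
as s → 1 (`powerRate_le`, `le_powerRate`).

For the upper bound on α₁, an estimator yields a test between θ - ε and θ + ε. Hölder's inequality
bounds the mass of the tilted law p^s q^(1-s) on each side of the test by an error probability and a
neighbouring tilted mass. If both errors decayed faster than ρ (2ε)^κ with ρ > A₁/κ, suitable orders
close to 1 would make the two bounds too small to add up to the total mass (`worstRate_le`,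
`eventually_iSup_worstRate_le`).

The bound is attained because the sample minimum exceeds θ + a almost surely: the shifted minimum
errs only if every observation is at least θ + a + 2ε, and that probability is an exact n-th power
(`iidLaw_shiftedMin`). -/

namespace LargeDeviation

/-! ### The digamma series and the threshold t₀ -/

lemma differentiableAt_log_Gamma {x : ℝ} (hx : 0 < x) :
    DifferentiableAt ℝ (fun y => Real.log (Real.Gamma y)) x :=
  (Real.differentiableAt_Gamma (fun m => by
    have : (0 : ℝ) ≤ m := Nat.cast_nonneg m
    linarith)).log (Real.Gamma_pos_of_pos hx).ne'

lemma psi_add_one {x : ℝ} (hx : 0 < x) : psi (x + 1) = psi x + 1 / x := by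
  have h1 : (fun y => Real.log (Real.Gamma (y + 1))) =ᶠ[𝓝 x]
      fun y => Real.log y + Real.log (Real.Gamma y) := by
    filter_upwards [eventually_gt_nhds hx] with y hy
    rw [Real.Gamma_add_one hy.ne', Real.log_mul hy.ne' (Real.Gamma_pos_of_pos hy).ne']
  have h2 : deriv (fun y => Real.log (Real.Gamma (y + 1))) x = psi (x + 1) :=
    deriv_comp_add_const (fun y => Real.log (Real.Gamma y)) 1 x
  rw [← h2, h1.deriv_eq,
    deriv_fun_add (Real.differentiableAt_log hx.ne') (differentiableAt_log_Gamma hx),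
    Real.deriv_log, psi, one_div, add_comm]

lemma psi_monotoneOn : MonotoneOn psi (Ioi 0) := by
  have h : ConvexOn ℝ (Ioi 0) (fun y => Real.log (Real.Gamma y)) := Real.convexOn_log_Gamma
  exact h.monotoneOn_deriv fun x hx => differentiableAt_log_Gamma hx

/-- The remainder `ψ(1 + n + t) - ψ(1 + n)` of the series of `ψ(1 + t) - ψ(1)`. -/
noncomputable def psiRem (t : ℝ) (n : ℕ) : ℝ := psi (1 + n + t) - psi (1 + n)

lemma psiRem_succ {t : ℝ} (ht : 0 ≤ t) (n : ℕ) :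
    psiRem t n = psiRem t (n + 1) + t / ((n + 1) * (n + 1 + t)) := by
  have hn : (0 : ℝ) ≤ n := Nat.cast_nonneg n
  have h1 := psi_add_one (x := 1 + n + t) (by positivity)
  have h2 := psi_add_one (x := 1 + n) (by positivity)
  have e1 : (1 : ℝ) + (n + 1 : ℕ) + t = 1 + n + t + 1 := by push_cast; ring
  have e2 : (1 : ℝ) + (n + 1 : ℕ) = 1 + n + 1 := by push_cast; ring
  rw [psiRem, psiRem, e1, e2, h1, h2]
  field_simp
  ring

lemma psiRem_nonneg {t : ℝ} (ht : 0 ≤ t) (n : ℕ) : 0 ≤ psiRem t n := by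
  have hn : (0 : ℝ) ≤ n := Nat.cast_nonneg n
  exact sub_nonneg.2 (psi_monotoneOn (by simp; positivity) (by simp; positivity) (by linarith))

lemma psiRem_le {t : ℝ} (ht : 0 ≤ t) (ht1 : t ≤ 1) (n : ℕ) : psiRem t n ≤ 1 / (1 + n) := by
  have hn : (0 : ℝ) ≤ n := Nat.cast_nonneg n
  have h2 := psi_add_one (x := 1 + n) (by positivity)
  have := psi_monotoneOn (a := 1 + n + t) (b := 1 + n + 1) (by simp; positivity)
    (by simp; positivity) (by linarith)
  rw [psiRem]
  linarith

lemma tendsto_psiRem {t : ℝ} (ht : 0 ≤ t) (ht1 : t ≤ 1) :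
    Tendsto (psiRem t) atTop (𝓝 0) := by
  refine squeeze_zero (psiRem_nonneg ht) (psiRem_le ht ht1) ?_
  simpa [add_comm] using tendsto_one_div_add_atTop_nhds_zero_nat (𝕜 := ℝ)

lemma sum_add_psiRem {t : ℝ} (ht : 0 ≤ t) (n : ℕ) :
    ∑ k ∈ Finset.range n, t / ((k + 1) * (k + 1 + t)) + psiRem t n = psi (1 + t) - psi 1 := by
  induction n with
  | zero => simp [psiRem]
  | succ n ih => rw [← ih, psiRem_succ ht n, Finset.sum_range_succ]; ring

lemma hasSum_psi_sub {t : ℝ} (ht : 0 ≤ t) (ht1 : t ≤ 1) :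
    HasSum (fun k : ℕ => t / ((k + 1) * (k + 1 + t))) (psi (1 + t) - psi 1) := by
  rw [hasSum_iff_tendsto_nat_of_nonneg (fun k => by positivity)]
  have := (tendsto_const_nhds (x := psi (1 + t) - psi 1)).sub (tendsto_psiRem ht ht1)
  rw [sub_zero] at this
  refine this.congr fun n => ?_
  rw [← sum_add_psiRem ht n]; ring

/-- The product (n + t/2 + 1/2)(n + t/2 + 3/2) equals (n + 1 + t/2)² - 1/4, while (n + 1)(n + 1 + t)
equals (n + 1 + t/2)² - t²/4. For t ≤ 1 each series term is therefore below a telescoping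
difference. The error of this comparison is small enough to locate t₀ after a few terms. -/
lemma psiRem_le_telescope {t : ℝ} (ht : 0 ≤ t) (ht1 : t ≤ 1) (n : ℕ) :
    psiRem t n ≤ t / (n + t / 2 + 1 / 2) := by
  have hanti : Antitone fun n : ℕ => t / (n + t / 2 + 1 / 2) - psiRem t n := by
    refine antitone_nat_of_succ_le fun n => ?_
    have hn : (0 : ℝ) ≤ n := Nat.cast_nonneg n
    rw [psiRem_succ ht n]
    have : t / ((n + 1) * (n + 1 + t)) ≤
        t / (n + t / 2 + 1 / 2) - t / ((n + 1 : ℕ) + t / 2 + 1 / 2) := by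
      push_cast
      have e : t / (n + t / 2 + 1 / 2) - t / ((n : ℝ) + 1 + t / 2 + 1 / 2) =
          t / ((n + t / 2 + 1 / 2) * (n + 1 + t / 2 + 1 / 2)) := by
        field_simp; ring
      rw [e]
      refine div_le_div_of_nonneg_left ht (by positivity) ?_
      nlinarith
    linarith
  have hlim : Tendsto (fun n : ℕ => t / (n + t / 2 + 1 / 2) - psiRem t n) atTop (𝓝 0) := by
    have h1 : Tendsto (fun n : ℕ => t / ((n : ℝ) + t / 2 + 1 / 2)) atTop (𝓝 0) := by
      refine Tendsto.div_atTop tendsto_const_nhds ?_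
      exact tendsto_atTop_add_const_right _ _ (tendsto_atTop_add_const_right _ _
        tendsto_natCast_atTop_atTop)
    simpa using h1.sub (tendsto_psiRem ht ht1)
  linarith [hanti.le_of_tendsto hlim n]

/-- The telescoping comparison is reversed by shifting the denominators by e = 1/(8N): from index N
on, the gain 2eN = 1/4 outweighs the lost 1/4. -/
lemma telescope_le_psiRem {t : ℝ} (ht : 0 ≤ t) (ht1 : t ≤ 1) (N : ℕ) (hN : 1 ≤ N) :
    t / (N + t / 2 + 1 / 2 + 1 / (8 * N)) ≤ psiRem t N := by
  have hN0 : (1 : ℝ) ≤ N := by exact_mod_cast hN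
  set e : ℝ := 1 / (8 * N) with he
  have he0 : 0 < e := by positivity
  have heN : 8 * e * N = 1 := by rw [he]; field_simp
  have hanti : Antitone fun n : ℕ => psiRem t (N + n) - t / (N + n + t / 2 + 1 / 2 + e) := by
    refine antitone_nat_of_succ_le fun n => ?_
    have hn : (0 : ℝ) ≤ n := Nat.cast_nonneg n
    have hs := psiRem_succ ht (N + n)
    rw [← add_assoc, hs]
    have : t / (N + n + t / 2 + 1 / 2 + e) - t / (N + (n + 1 : ℕ) + t / 2 + 1 / 2 + e) ≤
        t / (((N + n : ℕ) + 1) * ((N + n : ℕ) + 1 + t)) := by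
      push_cast
      have e : t / (N + n + t / 2 + 1 / 2 + e) - t / ((N : ℝ) + (n + 1) + t / 2 + 1 / 2 + e) =
          t / ((N + n + t / 2 + 1 / 2 + e) * (N + n + 1 + t / 2 + 1 / 2 + e)) := by
        field_simp; ring
      rw [e]
      refine div_le_div_of_nonneg_left ht (by positivity) ?_
      nlinarith [mul_nonneg he0.le hn, mul_nonneg he0.le ht]
    linarith
  have hlim : Tendsto (fun n : ℕ => psiRem t (N + n) - t / (N + n + t / 2 + 1 / 2 + e))
      atTop (𝓝 0) := by
    have h1 : Tendsto (fun n : ℕ => t / ((N : ℝ) + n + t / 2 + 1 / 2 + e)) atTop (𝓝 0) := by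
      refine Tendsto.div_atTop tendsto_const_nhds ?_
      exact tendsto_atTop_add_const_right _ _ (tendsto_atTop_add_const_right _ _
        (tendsto_atTop_add_const_right _ _ (tendsto_atTop_add_const_left _ _
        tendsto_natCast_atTop_atTop)))
    have h2 : Tendsto (fun n : ℕ => psiRem t (N + n)) atTop (𝓝 0) := by
      simpa only [add_comm] using (tendsto_add_atTop_iff_nat N).2 (tendsto_psiRem ht ht1)
    simpa using h2.sub h1
  have := hanti.le_of_tendsto hlim 0
  simp only [add_zero, Nat.cast_zero] at this
  linarith

lemma continuousOn_psi_sub : ContinuousOn (fun t => psi (1 + t) - psi 1) (Icc 0 1) := by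
  have h : ContinuousOn (fun t : ℝ => ∑' k : ℕ, t / ((k + 1) * (k + 1 + t))) (Icc 0 1) := by
    -- Weierstrass test: for t in [0, 1] the k-th term is at most 1/(k + 1)².
    refine continuousOn_tsum (u := fun k : ℕ => 1 / ((k : ℝ) + 1) ^ 2) (fun k => ?_) ?_ ?_
    · refine ContinuousOn.div (by fun_prop) (by fun_prop) fun t ht => ?_
      have := ht.1
      positivity
    · exact_mod_cast (summable_nat_add_iff 1).2 (Real.summable_one_div_nat_pow.2 one_lt_two)
    · intro k t ht
      have := ht.1
      rw [Real.norm_of_nonneg (by positivity), div_le_div_iff₀ (by positivity) (by positivity)]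
      have h2 := ht.2
      nlinarith [mul_nonneg (Nat.cast_nonneg (α := ℝ) k) this,
        mul_nonneg (Nat.cast_nonneg (α := ℝ) k) (sub_nonneg.2 h2),
        mul_nonneg (mul_nonneg (Nat.cast_nonneg (α := ℝ) k) (Nat.cast_nonneg (α := ℝ) k))
          (sub_nonneg.2 h2)]
  exact h.congr fun t ht => (hasSum_psi_sub ht.1 ht.2).tsum_eq.symm

/-- The function whose unique solution of `thresholdFun t = 1` is the threshold `t₀`. -/
noncomputable def thresholdFun (t : ℝ) : ℝ := 2 * t + t * (1 - t) * (psi (1 + t) - psi 1)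

lemma psi_sub_nonneg {t : ℝ} (ht : 0 ≤ t) : 0 ≤ psi (1 + t) - psi 1 := by
  simpa [psiRem] using psiRem_nonneg ht 0

lemma thresholdFun_strictMonoOn : StrictMonoOn thresholdFun (Icc 0 (1 / 2)) := by
  intro x hx y hy hxy
  have h1 : psi (1 + x) ≤ psi (1 + y) :=
    psi_monotoneOn (by simp; linarith [hx.1]) (by simp; linarith [hy.1]) (by linarith)
  have h2 := psi_sub_nonneg hx.1
  have h3 : x * (1 - x) ≤ y * (1 - y) := by nlinarith [hx.1, hy.2]
  have h4 : 0 ≤ y * (1 - y) := by nlinarith [hy.1, hy.2]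
  have := mul_le_mul h3 (sub_le_sub_right h1 (psi 1)) h2 h4
  unfold thresholdFun
  linarith

lemma thresholdFun_lower : thresholdFun 0.4325 < 1 := by
  -- Six exact terms and the telescoping tail bound suffice on this side; eight are used on the
  -- other.
  have h := sum_add_psiRem (t := 0.4325) (by norm_num) 6
  have h2 := psiRem_le_telescope (t := 0.4325) (by norm_num) (by norm_num) 6
  unfold thresholdFun
  rw [← h]
  norm_num [Finset.sum_range_succ] at h2 ⊢
  linarith

lemma thresholdFun_upper : 1 < thresholdFun 0.4327 := by
  have h := sum_add_psiRem (t := 0.4327) (by norm_num) 8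
  have h2 := telescope_le_psiRem (t := 0.4327) (by norm_num) (by norm_num) 8 (by norm_num)
  unfold thresholdFun
  rw [← h]
  norm_num [Finset.sum_range_succ] at h2 ⊢
  linarith

lemma exists_threshold : ∃ t ∈ Ioo (0.4325 : ℝ) 0.4327, thresholdFun t = 1 := by
  have hc : ContinuousOn thresholdFun (Icc 0.4325 0.4327) := by
    have := continuousOn_psi_sub.mono (Icc_subset_Icc (show (0 : ℝ) ≤ 0.4325 by norm_num)
      (show (0.4327 : ℝ) ≤ 1 by norm_num))
    unfold thresholdFun
    fun_prop
  exact intermediate_value_Ioo (by norm_num) hc ⟨thresholdFun_lower, thresholdFun_upper⟩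

/-- Strict monotonicity settles t ≤ 1/2; beyond that 2t alone is at least 1. It will be applied to t
= 2 - κ. -/
lemma one_le_thresholdFun {t₀ t : ℝ} (h0 : t₀ ∈ Ioo (0 : ℝ) (1 / 2)) (h1 : thresholdFun t₀ = 1)
    (ht : t₀ < t) (ht1 : t < 1) : 1 ≤ thresholdFun t := by
  have ht0 := h0.1.trans ht
  rcases le_total t (1 / 2) with h | h
  · rw [← h1]
    exact (thresholdFun_strictMonoOn ⟨h0.1.le, h0.2.le⟩ ⟨ht0.le, h⟩ ht).le
  · have := mul_nonneg (mul_nonneg ht0.le (sub_nonneg.2 ht1.le)) (psi_sub_nonneg ht0.le)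
    unfold thresholdFun
    linarith

/-! ### The weighted AM-GM gap -/

/-- The gap `s x + (1 - s) y - x ^ s y ^ (1 - s)` in the weighted AM-GM inequality. -/
noncomputable def amgmGap (s x y : ℝ) : ℝ := s * x + (1 - s) * y - x ^ s * y ^ (1 - s)

lemma amgmGap_nonneg {s x y : ℝ} (hs : s ∈ Ioo (0 : ℝ) 1) (hx : 0 ≤ x) (hy : 0 ≤ y) :
    0 ≤ amgmGap s x y :=
  sub_nonneg.2 (Real.geom_mean_le_arith_mean2_weighted hs.1.le (sub_nonneg.2 hs.2.le) hx hy
    (by ring))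

/-- The gaps of orders s and 1 - s add up to x + y minus two terms whose product is xy, hence to at
most x + y - 2√(xy). As the gap of order 1 - s is nonnegative, the other one obeys the same bound.
The bound no longer involves s, and this is the source of all uniformity in s. -/
lemma amgmGap_le_sq_sqrt_sub {s x y : ℝ} (hs : s ∈ Ioo (0 : ℝ) 1) (hx : 0 ≤ x) (hy : 0 ≤ y) :
    amgmGap s x y ≤ (√x - √y) ^ 2 := by
  have h1 := Real.geom_mean_le_arith_mean2_weighted (sub_nonneg.2 hs.2.le) hs.1.le hx hy (by ring)
  have e : (x ^ s * y ^ (1 - s)) * (x ^ (1 - s) * y ^ s) = (√x * √y) ^ 2 := by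
    have hx' : x ^ s * x ^ (1 - s) = x := by
      rw [← Real.rpow_add' hx (by norm_num)]; norm_num
    have hy' : y ^ (1 - s) * y ^ s = y := by
      rw [← Real.rpow_add' hy (by norm_num)]; norm_num
    rw [mul_pow, Real.sq_sqrt hx, Real.sq_sqrt hy]
    calc _ = (x ^ s * x ^ (1 - s)) * (y ^ (1 - s) * y ^ s) := by ring
      _ = x * y := by rw [hx', hy']
  have hp : 0 ≤ x ^ s * y ^ (1 - s) := by positivity
  have hq : 0 ≤ x ^ (1 - s) * y ^ s := by positivity
  have h2 : 2 * (√x * √y) ≤ x ^ s * y ^ (1 - s) + x ^ (1 - s) * y ^ s := by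
    refine (pow_le_pow_iff_left₀ (by positivity) (by positivity) two_ne_zero).1 ?_
    nlinarith [sq_nonneg (x ^ s * y ^ (1 - s) - x ^ (1 - s) * y ^ s)]
  have e2 : (√x - √y) ^ 2 = x + y - 2 * (√x * √y) := by
    rw [sub_sq, Real.sq_sqrt hx, Real.sq_sqrt hy]; ring
  rw [e2, amgmGap]
  linarith

lemma sq_sqrt_sub_le_add {x y : ℝ} (hx : 0 ≤ x) (hy : 0 ≤ y) : (√x - √y) ^ 2 ≤ x + y := by
  have : 0 ≤ √x * √y := by positivity
  nlinarith [Real.sq_sqrt hx, Real.sq_sqrt hy]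

lemma amgmGap_mul {s c x y : ℝ} (hc : 0 ≤ c) (hx : 0 ≤ x) (hy : 0 ≤ y) :
    amgmGap s (c * x) (c * y) = c * amgmGap s x y := by
  have : c ^ s * c ^ (1 - s) = c := by
    rw [← Real.rpow_add' hc (by norm_num)]; norm_num
  rw [amgmGap, amgmGap, Real.mul_rpow hc hx, Real.mul_rpow hc hy]
  linear_combination (-(x ^ s * y ^ (1 - s))) * this

lemma amgmGap_zero_right {s : ℝ} (x : ℝ) (hs : s ∈ Ioo (0 : ℝ) 1) : amgmGap s x 0 = s * x := by
  rw [amgmGap, Real.zero_rpow (by linarith [hs.2])]; ring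

lemma measurable_amgmGap {β : Type*} [MeasurableSpace β] {s : ℝ} {f g : β → ℝ}
    (hf : Measurable f) (hg : Measurable g) : Measurable fun x => amgmGap s (f x) (g x) := by
  unfold amgmGap
  fun_prop

/-- AM-GM bounds the geometric mean from above; the same bound for the inverses, with 1 - z ≤ z⁻¹ -
1, bounds it from below. No constant depends on s. -/
lemma abs_rpow_mul_rpow_sub_one_le {s ρ σ : ℝ} (hs : s ∈ Ioo (0 : ℝ) 1) (hρ : 0 < ρ)
    (hσ : 0 < σ) : |ρ ^ s * σ ^ (1 - s) - 1| ≤ |ρ - 1| + |σ - 1| + |ρ⁻¹ - 1| + |σ⁻¹ - 1| := by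
  have key : ∀ {ρ σ : ℝ}, 0 < ρ → 0 < σ → ρ ^ s * σ ^ (1 - s) - 1 ≤ |ρ - 1| + |σ - 1| := by
    intro ρ σ hρ hσ
    have h1 := Real.geom_mean_le_arith_mean2_weighted hs.1.le (sub_nonneg.2 hs.2.le) hρ.le hσ.le
      (by ring)
    have h2 : s * (ρ - 1) ≤ |ρ - 1| := by
      nlinarith [le_abs_self (ρ - 1), abs_nonneg (ρ - 1), hs.1, hs.2]
    have h3 : (1 - s) * (σ - 1) ≤ |σ - 1| := by
      nlinarith [le_abs_self (σ - 1), abs_nonneg (σ - 1), hs.1, hs.2]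
    linarith
  have h1 := key hρ hσ
  have h2 := key (inv_pos.2 hρ) (inv_pos.2 hσ)
  rw [Real.inv_rpow hρ.le, Real.inv_rpow hσ.le, ← mul_inv] at h2
  have hp : 0 < ρ ^ s * σ ^ (1 - s) := by positivity
  set z := ρ ^ s * σ ^ (1 - s)
  have h3 : 1 - z ≤ z⁻¹ - 1 := by
    have : z * z⁻¹ = 1 := mul_inv_cancel₀ hp.ne'
    nlinarith [sq_nonneg (z - 1), inv_pos.2 hp, mul_nonneg (inv_pos.2 hp).le (sq_nonneg (z - 1))]
  rw [abs_le]
  constructor <;> linarith [abs_nonneg (ρ - 1), abs_nonneg (σ - 1), abs_nonneg (ρ⁻¹ - 1),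
    abs_nonneg (σ⁻¹ - 1)]

/-- The order is allowed to vary along the filter; this is how convergence uniform in s is expressed
throughout. The arguments are compared with their limits through ratios, so both limits must be
positive. -/
lemma tendsto_amgmGap_sub {ι : Type*} {l : Filter ι} {s x y : ι → ℝ} {x₀ y₀ : ℝ}
    (hs : ∀ᶠ i in l, s i ∈ Ioo (0 : ℝ) 1) (hx : Tendsto x l (𝓝 x₀)) (hy : Tendsto y l (𝓝 y₀))
    (hx₀ : 0 < x₀) (hy₀ : 0 < y₀) :
    Tendsto (fun i => amgmGap (s i) (x i) (y i) - amgmGap (s i) x₀ y₀) l (𝓝 0) := by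
  have hρ : Tendsto (fun i => x i / x₀) l (𝓝 1) := by
    simpa [div_self hx₀.ne'] using hx.div_const x₀
  have hσ : Tendsto (fun i => y i / y₀) l (𝓝 1) := by
    simpa [div_self hy₀.ne'] using hy.div_const y₀
  have hb : Tendsto (fun i => |x i - x₀| + |y i - y₀| + (|x i / x₀ - 1| + |y i / y₀ - 1| +
      |(x i / x₀)⁻¹ - 1| + |(y i / y₀)⁻¹ - 1|) * (x₀ + y₀)) l (𝓝 0) := by
    have := ((((hx.sub_const x₀).abs.add (hy.sub_const y₀).abs)).add
      (((((hρ.sub_const 1).abs.add (hσ.sub_const 1).abs).add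
        (((hρ.inv₀ one_ne_zero).sub_const 1).abs)).add
        (((hσ.inv₀ one_ne_zero).sub_const 1).abs)).mul_const (x₀ + y₀)))
    simpa using this
  refine squeeze_zero_norm' ?_ hb
  filter_upwards [hs, hx.eventually (lt_mem_nhds hx₀), hy.eventually (lt_mem_nhds hy₀)]
    with i hsi hxi hyi
  have h1 := abs_rpow_mul_rpow_sub_one_le hsi (div_pos hxi hx₀) (div_pos hyi hy₀)
  rw [Real.div_rpow hxi.le hx₀.le, Real.div_rpow hyi.le hy₀.le] at h1
  have hp : 0 < x₀ ^ s i * y₀ ^ (1 - s i) := by positivity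
  have h2 : x₀ ^ s i * y₀ ^ (1 - s i) ≤ x₀ + y₀ := by
    have := Real.geom_mean_le_arith_mean2_weighted hsi.1.le (sub_nonneg.2 hsi.2.le) hx₀.le hy₀.le
      (by ring)
    nlinarith [hsi.1, hsi.2]
  have e : amgmGap (s i) (x i) (y i) - amgmGap (s i) x₀ y₀ =
      s i * (x i - x₀) + (1 - s i) * (y i - y₀) -
      (x i ^ s i / x₀ ^ s i * (y i ^ (1 - s i) / y₀ ^ (1 - s i)) - 1) *
        (x₀ ^ s i * y₀ ^ (1 - s i)) := by
    have h1 : x₀ ^ s i ≠ 0 := by positivity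
    have h2 : y₀ ^ (1 - s i) ≠ 0 := by positivity
    unfold amgmGap
    field_simp
    ring
  rw [e, Real.norm_eq_abs]
  refine (abs_sub _ _).trans (add_le_add ((abs_add_le _ _).trans (add_le_add ?_ ?_)) ?_)
  · rw [abs_mul, abs_of_pos hsi.1]
    exact mul_le_of_le_one_left (abs_nonneg _) hsi.2.le
  · rw [abs_mul, abs_of_pos (sub_pos.2 hsi.2)]
    exact mul_le_of_le_one_left (abs_nonneg _) (by linarith [hsi.1])
  · rw [abs_mul, abs_of_pos hp]
    exact mul_le_mul h1 h2 hp.le (by positivity)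

lemma tendsto_amgmGap_zero_sub {ι : Type*} {l : Filter ι} {s x : ι → ℝ} {x₀ : ℝ}
    (hs : ∀ᶠ i in l, s i ∈ Ioo (0 : ℝ) 1) (hx : Tendsto x l (𝓝 x₀)) :
    Tendsto (fun i => amgmGap (s i) (x i) 0 - amgmGap (s i) x₀ 0) l (𝓝 0) := by
  have hb : Tendsto (fun i => |x i - x₀|) l (𝓝 0) := by
    simpa using (hx.sub_const x₀).abs
  refine squeeze_zero_norm' ?_ hb
  filter_upwards [hs] with i hsi
  rw [amgmGap_zero_right _ hsi, amgmGap_zero_right _ hsi, ← mul_sub, Real.norm_eq_abs, abs_mul,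
    abs_of_pos hsi.1]
  exact mul_le_of_le_one_left (abs_nonneg _) hsi.2.le

/-! ### The Kullback-Leibler integral of a shifted power -/

lemma hasSum_telescope {f : ℕ → ℝ} (hf : Antitone f) (h0 : Tendsto f atTop (𝓝 0)) :
    HasSum (fun n => f n - f (n + 1)) (f 0) := by
  rw [hasSum_iff_tendsto_nat_of_nonneg fun n => sub_nonneg.2 (hf n.le_succ)]
  simp_rw [Finset.sum_range_sub']
  simpa using tendsto_const_nhds.sub h0

lemma hasSum_one_div_add_telescope {c : ℝ} (hc : 0 < c) :
    HasSum (fun n : ℕ => 1 / ((n : ℝ) + c) - 1 / ((n : ℝ) + 1 + c)) (1 / c) := by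
  have := hasSum_telescope (f := fun n : ℕ => 1 / ((n : ℝ) + c)) (fun m n h => by
    have : (m : ℝ) ≤ n := by exact_mod_cast h
    exact one_div_le_one_div_of_le (by positivity) (by linarith)) ?_
  · simpa using this
  · exact tendsto_const_nhds.div_atTop
      (tendsto_atTop_add_const_right _ _ tendsto_natCast_atTop_atTop)

/-- The series `∑_{k ≥ 2} α / (k (k - 1 - α))`. -/
lemma hasSum_psi_series {α : ℝ} (h0 : 0 < α) (h1 : α < 1) :
    HasSum (fun n : ℕ => α / (((n : ℝ) + 2) * (n + (1 - α))))
      (α / (1 + α) * (1 / (1 - α) + 1 - (psi (1 + (1 - α)) - psi 1))) := by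
  -- The partial fraction 1/(n + 1 - α) - 1/(n + 2) is two telescoping differences minus the digamma
  -- term 1/(n + 1) - 1/(n + 2 - α).
  have hA := hasSum_one_div_add_telescope (c := 1 - α) (by linarith)
  have hB := hasSum_one_div_add_telescope (c := 1) one_pos
  have hC := hasSum_psi_sub (t := 1 - α) (by linarith) (by linarith)
  have := ((hA.add hB).sub hC).mul_left (α / (1 + α))
  rw [div_one] at this
  refine this.congr_fun ?_
  intro n
  have hn : (0 : ℝ) ≤ n := Nat.cast_nonneg n
  have : (n : ℝ) + (1 - α) ≠ 0 := by have := sub_pos.2 h1; positivity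
  have : (n : ℝ) + 1 + (1 - α) ≠ 0 := by have := sub_pos.2 h1; positivity
  field_simp
  ring

/-- With t = 1 - α, clearing denominators turns the inequality into 1 ≤ 2t + t(1 - t)(ψ(1 + t) -
ψ(1)). This is where the equation defining t₀ comes from. -/
lemma series_le_one {α : ℝ} (h0 : 0 < α) (h1 : α < 1) (h : 1 ≤ thresholdFun (1 - α)) :
    α / (1 + α) * (1 / (1 - α) + 1 - (psi (1 + (1 - α)) - psi 1)) ≤ 1 := by
  have h2 := sub_pos.2 h1
  unfold thresholdFun at h
  set D := psi (1 + (1 - α)) - psi 1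
  rw [div_mul_eq_mul_div, div_le_one (by positivity)]
  have e : α * (1 / (1 - α) + 1 - D) = α * (1 + (1 - α) - (1 - α) * D) / (1 - α) := by
    field_simp
  rw [e, div_le_iff₀ h2]
  nlinarith

lemma tendsto_add_one_rpow_sub {α : ℝ} (h0 : 0 < α) (h1 : α < 1) :
    Tendsto (fun u : ℝ => (u + 1) ^ α - u ^ α) atTop (𝓝 0) := by
  have hb : Tendsto (fun u : ℝ => α * u ^ (α - 1)) atTop (𝓝 0) := by
    have := (tendsto_rpow_neg_atTop (y := 1 - α) (by linarith)).const_mul α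
    simpa using this
  refine squeeze_zero' ?_ ?_ hb
  · filter_upwards [eventually_gt_atTop 0] with u hu
    exact sub_nonneg.2 (Real.rpow_le_rpow hu.le (by linarith) h0.le)
  · filter_upwards [eventually_gt_atTop 0] with u hu
    have h := rpow_one_add_le_one_add_mul_self (s := 1 / u) (p := α)
      (by have : 0 < 1 / u := by positivity
          linarith) h0.le h1.le
    have e : u + 1 = u * (1 + 1 / u) := by field_simp
    rw [e, Real.mul_rpow hu.le (by positivity), Real.rpow_sub_one hu.ne']
    have := mul_le_mul_of_nonneg_left h (Real.rpow_nonneg hu.le α)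
    calc _ ≤ u ^ α * (1 + α * (1 / u)) - u ^ α := by linarith
      _ = _ := by field_simp; ring

lemma rpow_sub_le_tangent {α x y : ℝ} (h0 : 0 < α) (h1 : α < 1) (hx : 0 < x) (hy : 0 ≤ y) :
    y ^ α - x ^ α ≤ α * x ^ (α - 1) * (y - x) := by
  have h := rpow_one_add_le_one_add_mul_self (s := (y - x) / x) (p := α) (by
    rw [le_div_iff₀ hx]; linarith) h0.le h1.le
  have e : y = x * (1 + (y - x) / x) := by field_simp; ring
  have hnn : 0 ≤ 1 + (y - x) / x := by
    have : 0 ≤ y / x := by positivity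
    have e : 1 + (y - x) / x = y / x := by field_simp; ring
    rw [e]; exact this
  have e2 : y ^ α = x ^ α * (1 + (y - x) / x) ^ α := by
    conv_lhs => rw [e]
    rw [Real.mul_rpow hx.le hnn]
  rw [e2, Real.rpow_sub_one hx.ne']
  have := mul_le_mul_of_nonneg_left h (Real.rpow_nonneg hx.le α)
  calc _ ≤ x ^ α * (1 + α * ((y - x) / x)) - x ^ α := by linarith
    _ = _ := by field_simp; ring

/-- The integrand has an explicit antiderivative and is nonpositive by concavity of the power, so
its integrability follows from the limit of the antiderivative. Bernoulli's inequality traps that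
limit between 0 and (u + 1)^α - u^α. -/
lemma integral_tangent_remainder {α : ℝ} (h0 : 0 < α) (h1 : α < 1) :
    IntegrableOn (fun u : ℝ => u ^ α - (u + 1) ^ α + α * (u + 1) ^ (α - 1)) (Ioi 0) ∧
    ∫ u in Ioi (0 : ℝ), (u ^ α - (u + 1) ^ α + α * (u + 1) ^ (α - 1)) = 1 / (1 + α) - 1 := by
  set F : ℝ → ℝ := fun u => (u ^ (1 + α) - (u + 1) ^ (1 + α)) / (1 + α) + (u + 1) ^ α with hF
  have hcont : ContinuousWithinAt F (Ici 0) 0 := by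
    refine ContinuousAt.continuousWithinAt ?_
    have e1 : ContinuousAt (fun u : ℝ => u ^ (1 + α)) 0 :=
      (Real.continuous_rpow_const (by linarith)).continuousAt
    have e2 : ContinuousAt (fun u : ℝ => (u + 1) ^ (1 + α)) 0 :=
      ((Real.continuous_rpow_const (by linarith)).comp (continuous_add_const 1)).continuousAt
    have e3 : ContinuousAt (fun u : ℝ => (u + 1) ^ α) 0 :=
      ((Real.continuous_rpow_const h0.le).comp (continuous_add_const 1)).continuousAt
    exact ((e1.sub e2).div_const _).add e3
  have hderiv : ∀ u ∈ Ioi (0 : ℝ),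
      HasDerivAt F (u ^ α - (u + 1) ^ α + α * (u + 1) ^ (α - 1)) u := by
    intro u hu
    have hu' : (0 : ℝ) < u := hu
    have d1 := Real.hasDerivAt_rpow_const (x := u) (p := 1 + α) (Or.inl hu'.ne')
    have d2 := ((hasDerivAt_id u).add_const 1).rpow_const (p := 1 + α)
      (Or.inl (by simp; positivity))
    have d3 := ((hasDerivAt_id u).add_const 1).rpow_const (p := α)
      (Or.inl (by simp; positivity))
    refine (((d1.sub d2).div_const (1 + α)).add d3).congr_deriv ?_
    have e : (1 : ℝ) + α - 1 = α := by ring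
    rw [e]
    field_simp
    simp
  have hneg : ∀ u ∈ Ioi (0 : ℝ), u ^ α - (u + 1) ^ α + α * (u + 1) ^ (α - 1) ≤ 0 := by
    intro u hu
    have hu' : (0 : ℝ) < u := hu
    have := rpow_sub_le_tangent h0 h1 (x := u + 1) (y := u) (by positivity) hu'.le
    linarith
  have hlim : Tendsto F atTop (𝓝 0) := by
    have hL := tendsto_add_one_rpow_sub h0 h1
    refine squeeze_zero' ?_ ?_ hL
    · filter_upwards [eventually_gt_atTop 0] with u hu
      have hu' : (0 : ℝ) < u := hu
      have h := one_add_mul_self_le_rpow_one_add (s := -1 / (u + 1)) (p := 1 + α) (by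
        rw [le_div_iff₀ (by positivity)]; linarith) (by linarith)
      have e : u = (u + 1) * (1 + -1 / (u + 1)) := by field_simp; ring
      have hnn : 0 ≤ 1 + -1 / (u + 1) := by
        have e : 1 + -1 / (u + 1) = u / (u + 1) := by field_simp; ring
        rw [e]; positivity
      have e2 : u ^ (1 + α) = (u + 1) ^ (1 + α) * (1 + -1 / (u + 1)) ^ (1 + α) := by
        conv_lhs => rw [e]
        rw [Real.mul_rpow (by positivity) hnn]
      have := mul_le_mul_of_nonneg_left h (Real.rpow_nonneg (x := u + 1) (by positivity) (1 + α))
      have e3 : (u + 1) ^ (1 + α) = (u + 1) * (u + 1) ^ α := by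
        rw [Real.rpow_add (by positivity), Real.rpow_one]
      have e4 : (u + 1) ^ (1 + α) * (1 + (1 + α) * (-1 / (u + 1))) =
          (u + 1) ^ (1 + α) - (1 + α) * (u + 1) ^ α := by
        rw [e3]; field_simp; ring
      have : -(u + 1) ^ α ≤ (u ^ (1 + α) - (u + 1) ^ (1 + α)) / (1 + α) := by
        rw [le_div_iff₀ (by positivity), e2]
        linarith
      simp only [hF]
      linarith
    · filter_upwards [eventually_gt_atTop 0] with u hu
      have hu' : (0 : ℝ) < u := hu
      have h := one_add_mul_self_le_rpow_one_add (s := 1 / u) (p := 1 + α) (by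
        have : 0 < 1 / u := by positivity
        linarith) (by linarith)
      have e2 : (u + 1) ^ (1 + α) = u ^ (1 + α) * (1 + 1 / u) ^ (1 + α) := by
        rw [← Real.mul_rpow hu'.le (by positivity)]
        congr 1
        field_simp
      have := mul_le_mul_of_nonneg_left h (Real.rpow_nonneg (x := u) (by positivity) (1 + α))
      have e3 : u ^ (1 + α) = u * u ^ α := by
        rw [Real.rpow_add (by positivity), Real.rpow_one]
      have e4 : u ^ (1 + α) * (1 + (1 + α) * (1 / u)) =
          u ^ (1 + α) + (1 + α) * u ^ α := by
        rw [e3]; field_simp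
      have : (u ^ (1 + α) - (u + 1) ^ (1 + α)) / (1 + α) ≤ -u ^ α := by
        rw [div_le_iff₀ (by positivity), e2]
        linarith
      simp only [hF]
      linarith
  refine ⟨integrableOn_Ioi_deriv_of_nonpos hcont hderiv hneg hlim, ?_⟩
  rw [integral_Ioi_of_hasDerivAt_of_nonpos hcont hderiv hneg hlim]
  simp only [hF, zero_add, Real.one_rpow, Real.zero_rpow (show 1 + α ≠ 0 by linarith)]
  ring

lemma integral_add_one_rpow {p : ℝ} (hp : p < -1) :
    IntegrableOn (fun u : ℝ => (u + 1) ^ p) (Ioi 0) ∧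
    ∫ u in Ioi (0 : ℝ), (u + 1) ^ p = -1 / (p + 1) := by
  have hmp := measurePreserving_add_right (volume : Measure ℝ) 1
  have hemb := measurableEmbedding_addRight (1 : ℝ)
  have hpre : (fun u : ℝ => u + 1) ⁻¹' Ioi 1 = Ioi 0 := by simp
  constructor
  · have h := (hmp.integrableOn_comp_preimage hemb (f := fun u : ℝ => u ^ p) (s := Ioi 1)).2
      (integrableOn_Ioi_rpow_of_lt hp one_pos)
    rwa [hpre] at h
  · have h := hmp.setIntegral_preimage_emb hemb (fun u : ℝ => u ^ p) (Ioi 1)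
    rw [hpre] at h
    rw [h, integral_Ioi_rpow_of_lt hp one_pos, Real.one_rpow]

/-- The Kullback-Leibler integrand of `(u + 1) ^ α` relative to `u ^ α`. -/
noncomputable def klKernel (α u : ℝ) : ℝ :=
  u ^ α - (u + 1) ^ α + α * (u + 1) ^ α * Real.log ((u + 1) / u)

/-- Expand log((u + 1)/u) = -log(1 - w) in powers of w = 1/(u + 1). The linear term yields α(u +
1)^(α - 1), which is not integrable at infinity; it is kept with the difference of powers, and the
remaining terms are integrable one by one. -/
lemma klKernel_hasSum (α : ℝ) {u : ℝ} (hu : 0 < u) :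
    HasSum (fun n : ℕ => α / (n + 2) * (u + 1) ^ (α - 2 - n))
      (klKernel α u - (u ^ α - (u + 1) ^ α + α * (u + 1) ^ (α - 1))) := by
  have hu1 : 0 < u + 1 := by linarith
  set w := 1 / (u + 1) with hw
  have hw0 : 0 < w := by positivity
  have hw1 : |w| < 1 := by
    rw [abs_of_pos hw0, hw, div_lt_one hu1]; linarith
  have h := Real.hasSum_pow_div_log_of_abs_lt_one hw1
  have e : -Real.log (1 - w) = Real.log ((u + 1) / u) := by
    have h1 : 1 - w = u / (u + 1) := by rw [hw]; field_simp; ring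
    rw [← Real.log_inv, h1, inv_div]
  rw [e, ← hasSum_nat_add_iff' 1] at h
  have h2 := h.mul_left (α * (u + 1) ^ α)
  have e2 : klKernel α u - (u ^ α - (u + 1) ^ α + α * (u + 1) ^ (α - 1)) =
      α * (u + 1) ^ α * (Real.log ((u + 1) / u) -
        ∑ i ∈ Finset.range 1, w ^ (i + 1) / ((i : ℝ) + 1)) := by
    rw [Real.rpow_sub_one hu1.ne']
    simp only [klKernel, Finset.range_one, Finset.sum_singleton, hw]
    norm_num
    field_simp
  rw [e2]
  refine h2.congr_fun ?_
  intro n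
  rw [show α - 2 - (n : ℝ) = α - ((n + 2 : ℕ) : ℝ) by push_cast; ring, Real.rpow_sub hu1,
    Real.rpow_natCast, hw, div_pow, one_pow]
  push_cast
  field_simp
  ring

lemma integral_klKernel {α : ℝ} (h0 : 0 < α) (h1 : α < 1) :
    IntegrableOn (klKernel α) (Ioi 0) ∧
    ∫ u in Ioi (0 : ℝ), klKernel α u = 1 / (1 + α) - 1 +
      α / (1 + α) * (1 / (1 - α) + 1 - (psi (1 + (1 - α)) - psi 1)) := by
  have hser := hasSum_psi_series h0 h1
  obtain ⟨hB, hBv⟩ := integral_tangent_remainder h0 h1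
  set F : ℕ → ℝ → ℝ := fun n u => α / (n + 2) * (u + 1) ^ (α - 2 - n) with hF
  have hp : ∀ n : ℕ, α - 2 - n < -1 := fun n => by
    have : (0 : ℝ) ≤ n := Nat.cast_nonneg n
    linarith
  have hint : ∀ n, IntegrableOn (F n) (Ioi 0) := fun n =>
    (integral_add_one_rpow (hp n)).1.const_mul _
  have hval : ∀ n, ∫ u in Ioi (0 : ℝ), F n u = α / (((n : ℝ) + 2) * (n + (1 - α))) := by
    intro n
    have hn : (0 : ℝ) ≤ n := Nat.cast_nonneg n
    have : (n : ℝ) + (1 - α) ≠ 0 := by have := sub_pos.2 h1; positivity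
    have : α - 2 - (n : ℝ) + 1 ≠ 0 := by linarith [hp n]
    simp only [hF]
    rw [integral_const_mul, (integral_add_one_rpow (hp n)).2]
    field_simp
    ring
  have hnorm : ∀ n, ∫ u in Ioi (0 : ℝ), ‖F n u‖ = ∫ u in Ioi (0 : ℝ), F n u := by
    intro n
    refine setIntegral_congr_fun measurableSet_Ioi fun u hu => ?_
    have hu' : (0 : ℝ) < u := hu
    exact Real.norm_of_nonneg (by simp only [hF]; positivity)
  have hsum : Summable fun n => ∫ u in Ioi (0 : ℝ), ‖F n u‖ := by
    simp_rw [hnorm, hval]; exact hser.summable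
  have hS := hasSum_integral_of_summable_integral_norm hint hsum
  simp_rw [hval] at hS
  have htsum : ∀ u ∈ Ioi (0 : ℝ), ∑' n, F n u =
      klKernel α u - (u ^ α - (u + 1) ^ α + α * (u + 1) ^ (α - 1)) := fun u hu =>
    (klKernel_hasSum α hu).tsum_eq
  have hval' := hS.unique hser
  have hpos : 0 < α / (1 + α) * (1 / (1 - α) + 1 - (psi (1 + (1 - α)) - psi 1)) := by
    have := sub_pos.2 h1
    refine lt_of_lt_of_le ?_ (le_hasSum hser 0 fun n _ => by positivity)
    positivity
  -- A non-integrable function would have Bochner integral 0, whereas the sum of the series is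
  -- positive.
  have hI : IntegrableOn (fun u => ∑' n, F n u) (Ioi 0) := by
    by_contra hcon
    rw [integral_undef hcon] at hval'
    exact hpos.ne hval'
  have hfun : ∀ u ∈ Ioi (0 : ℝ), klKernel α u =
      (u ^ α - (u + 1) ^ α + α * (u + 1) ^ (α - 1)) + ∑' n, F n u := fun u hu => by
    rw [htsum u hu]; ring
  refine ⟨(integrableOn_congr_fun hfun measurableSet_Ioi).2 (hB.add hI), ?_⟩
  rw [setIntegral_congr_fun measurableSet_Ioi hfun, integral_add hB hI, hBv, hval']

/-! ### The rate of the pure power and its bounds -/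

/-- The truncated power `max(u, 0) ^ α`. -/
noncomputable def posPow (α u : ℝ) : ℝ := max u 0 ^ α

lemma posPow_nonneg (α u : ℝ) : 0 ≤ posPow α u := Real.rpow_nonneg (le_max_right _ _) _

lemma posPow_of_nonpos {α u : ℝ} (hα : 0 < α) (hu : u ≤ 0) : posPow α u = 0 := by
  rw [posPow, max_eq_right hu, Real.zero_rpow hα.ne']

lemma posPow_of_nonneg {α u : ℝ} (hu : 0 ≤ u) : posPow α u = u ^ α := by
  rw [posPow, max_eq_left hu]

lemma measurable_posPow (α : ℝ) : Measurable (posPow α) := by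
  unfold posPow; fun_prop

lemma sqrt_posPow (α u : ℝ) : √(posPow α u) = posPow (α / 2) u := by
  rw [posPow, posPow, Real.sqrt_eq_rpow, ← Real.rpow_mul (le_max_right _ _)]
  ring_nf

/-- An integrable function dominating the rescaled squared increments of a function that behaves
like a power near `0`. -/
noncomputable def incrementBound (α : ℝ) : ℝ → ℝ :=
  (Ioc (-1 : ℝ) 1).indicator (fun _ => 2) + (Ioi (1 : ℝ)).indicator fun u => u ^ (α - 2)

lemma integrable_incrementBound {α : ℝ} (h1 : α < 1) : Integrable (incrementBound α) := by
  refine Integrable.add ?_ ?_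
  · exact (integrable_indicator_iff measurableSet_Ioc).2 (by simp)
  · exact (integrable_indicator_iff measurableSet_Ioi).2
      (integrableOn_Ioi_rpow_of_lt (by linarith) one_pos)

lemma incrementBound_nonneg (α u : ℝ) : 0 ≤ incrementBound α u := by
  refine add_nonneg (indicator_nonneg (fun _ _ => by norm_num) _)
    (indicator_nonneg (fun x hx => ?_) _)
  exact Real.rpow_nonneg (zero_le_one.trans (le_of_lt hx)) _

/-- `r` vanishes on the left of `0`, and on `(0, D)` it is controlled by `x ^ (α / 2)` and its
increments by those of this power. -/
structure IsPowerLikeNearZero (r : ℝ → ℝ) (α C D : ℝ) : Prop where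
  eq_zero : ∀ x ≤ 0, r x = 0
  nonneg : ∀ x, 0 ≤ r x
  le : ∀ x, 0 < x → x < D → r x ≤ C * x ^ (α / 2)
  sub_le : ∀ x y, 0 < x → x ≤ y → y < D → |r y - r x| ≤ C * x ^ (α / 2 - 1) * (y - x)

lemma IsPowerLikeNearZero.sq_sub_le {r : ℝ → ℝ} {α C D : ℝ} (h : IsPowerLikeNearZero r α C D)
    (hα0 : 0 < α) (hα1 : α < 1) (hC : 0 ≤ C) {ε u : ℝ} (hε : 0 < ε) (hu : ε * (u + 1) < D) :
    (r (ε * (u + 1)) - r (ε * u)) ^ 2 ≤ ε ^ α * (C ^ 2 * incrementBound α u) := by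
  have hsq : ∀ x : ℝ, 0 ≤ x → (x ^ (α / 2)) ^ 2 = x ^ α := fun x hx => by
    rw [← Real.rpow_natCast, ← Real.rpow_mul hx]; norm_num
  -- Three regimes: both values vanish for u ≤ -1; each value is at most C(2ε)^(α/2) for -1 < u ≤ 1,
  -- and 2^α ≤ 2 gives the constant; for u > 1 the increment bound gives u^(α - 2).
  rcases le_or_gt u (-1) with h1 | h1
  · rw [h.eq_zero _ (mul_nonpos_of_nonneg_of_nonpos hε.le (by linarith)),
      h.eq_zero _ (mul_nonpos_of_nonneg_of_nonpos hε.le (by linarith))]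
    have := incrementBound_nonneg α u
    rw [sub_zero, zero_pow two_ne_zero]
    positivity
  rcases le_or_gt u 1 with h2 | h2
  · have e : incrementBound α u = 2 := by
      simp [incrementBound, indicator, h1, h2, not_lt.2 h2]
    have hu1 : 0 < u + 1 := by linarith
    have b : C * (ε * (u + 1)) ^ (α / 2) ≤ C * (ε * 2) ^ (α / 2) := by
      gcongr
      linarith
    have b1 := (h.le _ (mul_pos hε hu1) hu).trans b
    have b2 : r (ε * u) ≤ C * (ε * 2) ^ (α / 2) := by
      rcases le_or_gt u 0 with h3 | h3
      · rw [h.eq_zero _ (mul_nonpos_of_nonneg_of_nonpos hε.le h3)]; positivity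
      · refine (h.le _ (mul_pos hε h3) (by nlinarith)).trans ?_
        gcongr
        linarith
    have b3 : |r (ε * (u + 1)) - r (ε * u)| ≤ C * (ε * 2) ^ (α / 2) :=
      abs_le.2 ⟨by linarith [h.nonneg (ε * (u + 1))], by linarith [h.nonneg (ε * u)]⟩
    rw [e, ← sq_abs]
    calc _ ≤ (C * (ε * 2) ^ (α / 2)) ^ 2 := by gcongr
      _ = ε ^ α * (C ^ 2 * 2 ^ α) := by
        rw [mul_pow, hsq _ (by positivity), Real.mul_rpow hε.le (by norm_num)]; ring
      _ ≤ _ := by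
        gcongr
        calc (2 : ℝ) ^ α ≤ 2 ^ (1 : ℝ) :=
              Real.rpow_le_rpow_of_exponent_le (by norm_num) hα1.le
          _ = 2 := Real.rpow_one _
  · have hu0 : 0 < u := by linarith
    have e : incrementBound α u = u ^ (α - 2) := by
      simp [incrementBound, indicator, not_le.2 h2, h2]
    have b := h.sub_le (ε * u) (ε * (u + 1)) (by positivity) (by nlinarith) hu
    rw [e, ← sq_abs]
    calc _ ≤ (C * (ε * u) ^ (α / 2 - 1) * (ε * (u + 1) - ε * u)) ^ 2 := by gcongr
      _ = C ^ 2 * ((ε * u) ^ (α / 2 - 1)) ^ 2 * ε ^ 2 := by ring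
      _ = C ^ 2 * (ε * u) ^ (α - 2) * ε ^ 2 := by
        rw [← Real.rpow_natCast ((ε * u) ^ (α / 2 - 1)), ← Real.rpow_mul (by positivity)]
        congr 3
        push_cast; ring
      _ = ε ^ α * (C ^ 2 * u ^ (α - 2)) := by
        rw [Real.mul_rpow hε.le hu0.le, Real.rpow_sub hε, show ε ^ (2 : ℝ) = ε ^ 2 from
          Real.rpow_natCast ε 2]
        field_simp
      _ ≤ _ := le_rfl

lemma isPowerLikeNearZero_posPow {α D : ℝ} (h0 : 0 < α) (h1 : α < 1) :
    IsPowerLikeNearZero (posPow (α / 2)) α 1 D where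
  eq_zero x hx := posPow_of_nonpos (by linarith) hx
  nonneg x := posPow_nonneg _ x
  le x hx _ := by rw [posPow_of_nonneg hx.le, one_mul]
  sub_le x y hx hxy _ := by
    rw [posPow_of_nonneg hx.le, posPow_of_nonneg (hx.le.trans hxy),
      abs_of_nonneg (sub_nonneg.2 (Real.rpow_le_rpow hx.le hxy (by linarith)))]
    refine (rpow_sub_le_tangent (by linarith) (by linarith) hx (hx.le.trans hxy)).trans ?_
    have := sub_nonneg.2 hxy
    gcongr
    linarith

lemma sq_sqrt_posPow_sub_le {α : ℝ} (h0 : 0 < α) (h1 : α < 1) (u : ℝ) :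
    (√(posPow α (u + 1)) - √(posPow α u)) ^ 2 ≤ incrementBound α u := by
  have := (isPowerLikeNearZero_posPow (D := u + 2) h0 h1).sq_sub_le h0 h1 zero_le_one one_pos
    (u := u) (by linarith)
  simpa [sqrt_posPow] using this

/-- The rate `∫ (s p + (1 - s) q - p ^ s q ^ (1 - s))` for `p(u) = (u + 1)₊ ^ α` and
`q(u) = u₊ ^ α`. -/
noncomputable def powerRate (α s : ℝ) : ℝ := ∫ u, amgmGap s (posPow α (u + 1)) (posPow α u)

lemma integrable_amgmGap_posPow {α s : ℝ} (h0 : 0 < α) (h1 : α < 1) (hs : s ∈ Ioo (0 : ℝ) 1) :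
    Integrable fun u => amgmGap s (posPow α (u + 1)) (posPow α u) := by
  refine (integrable_incrementBound h1).mono' (measurable_amgmGap
    ((measurable_posPow α).comp (measurable_add_const 1))
    (measurable_posPow α)).aestronglyMeasurable (ae_of_all _ fun u => ?_)
  rw [Real.norm_of_nonneg (amgmGap_nonneg hs (posPow_nonneg _ _) (posPow_nonneg _ _))]
  exact (amgmGap_le_sq_sqrt_sub hs (posPow_nonneg _ _) (posPow_nonneg _ _)).trans
    (sq_sqrt_posPow_sub_le h0 h1 u)

lemma setIntegral_posPow {α : ℝ} (h0 : 0 < α) :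
    ∫ u in Iic (0 : ℝ), posPow α (u + 1) = 1 / (1 + α) := by
  have hmp := measurePreserving_add_right (volume : Measure ℝ) 1
  have hemb := measurableEmbedding_addRight (1 : ℝ)
  have h := hmp.setIntegral_preimage_emb hemb (posPow α) (Iic 1)
  have hpre : (fun u : ℝ => u + 1) ⁻¹' Iic 1 = Iic 0 := by simp
  rw [hpre] at h
  rw [h]
  have e : ∫ u in Iic (1 : ℝ), posPow α u = ∫ u in Ioc (0 : ℝ) 1, posPow α u := by
    refine setIntegral_eq_of_subset_of_forall_sdiff_eq_zero measurableSet_Iic Ioc_subset_Iic_self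
      fun u hu => ?_
    refine posPow_of_nonpos h0 ?_
    by_contra hcon
    exact hu.2 ⟨not_le.1 hcon, hu.1⟩
  rw [e, setIntegral_congr_fun measurableSet_Ioc
    (fun u (hu : u ∈ Ioc (0 : ℝ) 1) => posPow_of_nonneg (α := α) hu.1.le),
    ← intervalIntegral.integral_of_le zero_le_one, integral_rpow (Or.inl (by linarith))]
  rw [Real.one_rpow, Real.zero_rpow (by linarith)]
  ring

/-- For u ≤ 0 the second power vanishes and the gap is s times the first, so the uncovered interval
contributes exactly s/(1 + α). -/
lemma powerRate_eq {α s : ℝ} (h0 : 0 < α) (h1 : α < 1) (hs : s ∈ Ioo (0 : ℝ) 1) :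
    powerRate α s = s * (1 / (1 + α)) +
      ∫ u in Ioi (0 : ℝ), amgmGap s (posPow α (u + 1)) (posPow α u) := by
  have hI := integrable_amgmGap_posPow h0 h1 hs
  rw [powerRate, ← intervalIntegral.integral_Iic_add_Ioi (b := 0) hI.integrableOn hI.integrableOn]
  congr 1
  rw [← setIntegral_posPow h0, ← integral_const_mul]
  refine setIntegral_congr_fun measurableSet_Iic fun u hu => ?_
  rw [posPow_of_nonpos h0 hu, amgmGap_zero_right _ hs]

lemma le_powerRate {α s : ℝ} (h0 : 0 < α) (h1 : α < 1) (hs : s ∈ Ioo (0 : ℝ) 1) :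
    s * (1 / (1 + α)) ≤ powerRate α s := by
  rw [powerRate_eq h0 h1 hs]
  exact le_add_of_nonneg_right (integral_nonneg fun u =>
    amgmGap_nonneg hs (posPow_nonneg _ _) (posPow_nonneg _ _))

/-- With P = (u + 1)^α and Q = u^α, write P^s Q^(1-s) = P exp((1 - s) log(Q/P)) and use exp v ≥ 1 +
v. -/
lemma amgmGap_le_klKernel {α s u : ℝ} (hu : 0 < u) :
    amgmGap s (posPow α (u + 1)) (posPow α u) ≤ (1 - s) * klKernel α u := by
  have hu1 : 0 < u + 1 := by linarith
  rw [posPow_of_nonneg hu.le, posPow_of_nonneg hu1.le]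
  have hP : 0 < (u + 1) ^ α := by positivity
  have hQ : 0 < u ^ α := by positivity
  have e : ((u + 1) ^ α) ^ s * (u ^ α) ^ (1 - s) =
      (u + 1) ^ α * Real.exp ((1 - s) * (α * Real.log (u / (u + 1)))) := by
    rw [← Real.log_rpow (by positivity), mul_comm (1 - s), Real.exp_mul,
      Real.exp_log (by positivity), Real.div_rpow hu.le hu1.le, Real.div_rpow hQ.le hP.le,
      Real.rpow_sub hP, Real.rpow_one]
    field_simp
  have h := Real.add_one_le_exp ((1 - s) * (α * Real.log (u / (u + 1))))
  have hl : Real.log (u / (u + 1)) = -Real.log ((u + 1) / u) := by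
    rw [← Real.log_inv, inv_div]
  rw [amgmGap, e, klKernel]
  rw [hl] at h ⊢
  have := mul_le_mul_of_nonneg_left h hP.le
  nlinarith

/-- Both s/(1 + α) and (1 - s)K are controlled by 1/(1 + α): the threshold hypothesis says precisely
that K ≤ 1/(1 + α), and the weights add up to 1. -/
lemma powerRate_le {α s : ℝ} (h0 : 0 < α) (h1 : α < 1) (h : 1 ≤ thresholdFun (1 - α))
    (hs : s ∈ Ioo (0 : ℝ) 1) : powerRate α s ≤ 1 / (1 + α) := by
  obtain ⟨hk, hv⟩ := integral_klKernel h0 h1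
  have hle : ∫ u in Ioi (0 : ℝ), amgmGap s (posPow α (u + 1)) (posPow α u) ≤
      ∫ u in Ioi (0 : ℝ), (1 - s) * klKernel α u :=
    setIntegral_mono_on (integrable_amgmGap_posPow h0 h1 hs).integrableOn (hk.const_mul _)
      measurableSet_Ioi fun u hu => amgmGap_le_klKernel hu
  rw [integral_const_mul, hv] at hle
  have h2 := series_le_one h0 h1 h
  have h3 := sub_pos.2 hs.2
  rw [powerRate_eq h0 h1 hs]
  nlinarith

/-! ### Rescaling at an endpoint -/

lemma tendsto_const_add_nhdsGT (a : ℝ) :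
    Tendsto (fun x : ℝ => a + x) (𝓝[>] 0) (𝓝[>] a) := by
  refine tendsto_nhdsWithin_iff.2 ⟨?_, ?_⟩
  · have : Tendsto (fun x : ℝ => a + x) (𝓝 0) (𝓝 (a + 0)) := tendsto_const_nhds.add tendsto_id
    rw [add_zero] at this
    exact this.mono_left nhdsWithin_le_nhds
  · filter_upwards [self_mem_nhdsWithin] with x hx
    have : (0 : ℝ) < x := hx
    simpa using this

lemma tendsto_const_mul_nhdsGT_zero {c : ℝ} (hc : 0 < c) :
    Tendsto (fun x : ℝ => c * x) (𝓝[>] 0) (𝓝[>] 0) := by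
  refine tendsto_nhdsWithin_iff.2 ⟨?_, ?_⟩
  · have : Tendsto (fun x : ℝ => c * x) (𝓝 0) (𝓝 (c * 0)) := tendsto_id.const_mul c
    rw [mul_zero] at this
    exact this.mono_left nhdsWithin_le_nhds
  · filter_upwards [self_mem_nhdsWithin] with x hx
    exact mul_pos hc hx

lemma tendsto_rpow_nhdsGT_zero {p : ℝ} (hp : 0 < p) :
    Tendsto (fun x : ℝ => x ^ p) (𝓝[>] 0) (𝓝 0) := by
  have := (Real.continuousAt_rpow_const 0 p (Or.inr hp.le)).tendsto
  rw [Real.zero_rpow hp.ne'] at this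
  exact this.mono_left nhdsWithin_le_nhds

lemma eventually_prod_principal_Ioo :
    ∀ᶠ i : ℝ × ℝ in 𝓝[>] 0 ×ˢ 𝓟 (Ioo 0 1), 0 < i.1 ∧ i.2 ∈ Ioo (0 : ℝ) 1 :=
  (eventually_mem_nhdsWithin (a := (0 : ℝ)) (s := Ioi 0)).prod_mk (mem_principal_self _)

lemma hasDerivAt_sqrt_comp {g : ℝ → ℝ} {x : ℝ} (hg : 0 < g x) (hd : DifferentiableAt ℝ g x) :
    HasDerivAt (fun y => √(g y)) (deriv g x / (2 * √(g x))) x :=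
  hd.hasDerivAt.sqrt hg.ne'

lemma abs_deriv_div_two_sqrt_le {c d m : ℝ} (hc : 0 < c) (hm : 0 ≤ m) (h : d ^ 2 / c ≤ m ^ 2) :
    |d / (2 * √c)| ≤ m := by
  refine abs_le_of_sq_le_sq ?_ hm
  have : (d / (2 * √c)) ^ 2 = d ^ 2 / c / 4 := by
    rw [div_pow, mul_pow, Real.sq_sqrt hc.le]; field_simp; norm_num
  have h0 : 0 ≤ d ^ 2 / c := by positivity
  rw [this]
  linarith

lemma abs_sqrt_sub_sqrt_le {g : ℝ → ℝ} {x y m : ℝ} (hxy : x ≤ y)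
    (hg : ∀ z ∈ Icc x y, 0 < g z) (hd : ∀ z ∈ Icc x y, DifferentiableAt ℝ g z) (hm : 0 ≤ m)
    (hb : ∀ z ∈ Icc x y, deriv g z ^ 2 / g z ≤ m ^ 2) : |√(g y) - √(g x)| ≤ m * (y - x) := by
  have := (convex_Icc x y).norm_image_sub_le_of_norm_hasDerivWithin_le
    (f := fun z => √(g z)) (f' := fun z => deriv g z / (2 * √(g z))) (C := m)
    (fun z hz => (hasDerivAt_sqrt_comp (hg z hz) (hd z hz)).hasDerivWithinAt)
    (fun z hz => abs_deriv_div_two_sqrt_le (hg z hz) hm (hb z hz))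
    (left_mem_Icc.2 hxy) (right_mem_Icc.2 hxy)
  rwa [Real.norm_eq_abs, Real.norm_eq_abs, abs_of_nonneg (sub_nonneg.2 hxy)] at this

/-- The squared derivative of √g is g'²/(4g), so the hypothesis on g'²/g bounds that derivative by a
multiple of x^(α/2 - 1), and the mean value inequality gives the increments. The power being
decreasing, its value at the left end x serves for the whole segment. -/
lemma exists_isPowerLikeNearZero {g : ℝ → ℝ} {α A D₀ : ℝ} (hα : α < 1) (hD₀ : 0 < D₀)
    (h0 : ∀ x ≤ 0, g x = 0) (hpos : ∀ x, 0 < x → x < D₀ → 0 < g x)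
    (hdiff : ∀ x, 0 < x → x < D₀ → DifferentiableAt ℝ g x)
    (hlim : Tendsto (fun x => g x / x ^ α) (𝓝[>] 0) (𝓝 A))
    (hderiv : (fun x => deriv g x ^ 2 / g x) =O[𝓝[>] 0] fun x => x ^ (α - 2)) :
    ∃ C D, 0 ≤ C ∧ 0 < D ∧ D ≤ D₀ ∧ IsPowerLikeNearZero (fun x => √(g x)) α C D := by
  obtain ⟨c, hc⟩ := hderiv.bound
  have h1 : ∀ᶠ x in 𝓝[>] (0 : ℝ), g x / x ^ α < A + 1 := hlim.eventually (gt_mem_nhds (by linarith))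
  obtain ⟨D₁, hD₁, hD⟩ := mem_nhdsGT_iff_exists_Ioo_subset.1 (hc.and h1)
  have hD₁ : 0 < D₁ := hD₁
  set M := max (|A + 1|) |c|
  have hM : 0 ≤ M := (abs_nonneg _).trans (le_max_left _ _)
  refine ⟨√M, min D₀ D₁, Real.sqrt_nonneg _, lt_min hD₀ hD₁, min_le_left _ _, ?_, ?_, ?_, ?_⟩
  · intro x hx
    simp [h0 x hx]
  · exact fun x => Real.sqrt_nonneg _
  · intro x hx hxD
    have h := (hD ⟨hx, hxD.trans_le (min_le_right _ _)⟩).2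
    have h : g x / x ^ α < A + 1 := h
    have hx' : 0 < x ^ α := by positivity
    rw [div_lt_iff₀ hx'] at h
    have : g x ≤ M * x ^ α := h.le.trans
      (mul_le_mul_of_nonneg_right ((le_abs_self _).trans (le_max_left _ _)) hx'.le)
    calc √(g x) ≤ √(M * x ^ α) := Real.sqrt_le_sqrt this
      _ = √M * x ^ (α / 2) := by
        rw [Real.sqrt_mul hM, Real.sqrt_eq_rpow (x ^ α), ← Real.rpow_mul hx.le]
        ring_nf
  · intro x y hx hxy hy
    have hz : ∀ z ∈ Icc x y, 0 < z ∧ z < D₀ ∧ z < D₁ := fun z hz =>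
      ⟨hx.trans_le hz.1, (hz.2.trans_lt hy).trans_le (min_le_left _ _),
        (hz.2.trans_lt hy).trans_le (min_le_right _ _)⟩
    refine abs_sqrt_sub_sqrt_le hxy (fun z h => hpos z (hz z h).1 (hz z h).2.1)
      (fun z h => hdiff z (hz z h).1 (hz z h).2.1) (by positivity) fun z h => ?_
    obtain ⟨hz0, hz1, hz2⟩ := hz z h
    have hb : ‖deriv g z ^ 2 / g z‖ ≤ c * ‖z ^ (α - 2)‖ := (hD ⟨hz0, hz2⟩).1
    have hzp : 0 < z ^ (α - 2) := by positivity
    rw [Real.norm_of_nonneg (by have := hpos z hz0 hz1; positivity),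
      Real.norm_of_nonneg hzp.le] at hb
    have hzx : z ^ (α - 2) ≤ x ^ (α - 2) :=
      Real.rpow_le_rpow_of_nonpos hx h.1 (by linarith)
    have hxx : (x ^ (α / 2 - 1)) ^ 2 = x ^ (α - 2) := by
      rw [← Real.rpow_natCast, ← Real.rpow_mul hx.le]; congr 1; push_cast; ring
    rw [mul_pow, Real.sq_sqrt hM, hxx]
    calc _ ≤ c * z ^ (α - 2) := hb
      _ ≤ M * z ^ (α - 2) :=
        mul_le_mul_of_nonneg_right ((le_abs_self _).trans (le_max_right _ _)) hzp.le
      _ ≤ M * x ^ (α - 2) := mul_le_mul_of_nonneg_left hzx hM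

lemma tendsto_rescale {g : ℝ → ℝ} {α A : ℝ} (hα : 0 < α) (h0 : ∀ x ≤ 0, g x = 0)
    (hlim : Tendsto (fun x => g x / x ^ α) (𝓝[>] 0) (𝓝 A)) (u : ℝ) :
    Tendsto (fun ε => g (ε * u) / ε ^ α) (𝓝[>] 0) (𝓝 (A * posPow α u)) := by
  rcases le_or_gt u 0 with hu | hu
  · rw [posPow_of_nonpos hα hu, mul_zero]
    refine tendsto_const_nhds.congr' ?_
    filter_upwards [self_mem_nhdsWithin] with ε hε
    rw [h0 _ (mul_nonpos_of_nonneg_of_nonpos (le_of_lt hε) hu), zero_div]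
  · have ht : Tendsto (fun ε : ℝ => ε * u) (𝓝[>] 0) (𝓝[>] 0) := by
      simpa only [mul_comm] using tendsto_const_mul_nhdsGT_zero hu
    rw [posPow_of_nonneg hu.le]
    refine ((hlim.comp ht).mul_const (u ^ α)).congr' ?_
    filter_upwards [self_mem_nhdsWithin] with ε hε
    have hε' : (0 : ℝ) < ε := hε
    simp only [Function.comp]
    rw [Real.mul_rpow hε'.le hu.le]
    field_simp

lemma integral_rescale (F : ℝ → ℝ) {ε : ℝ} (hε : 0 < ε) :
    ∫ x, F x = ε * ∫ u, F (ε * u) := by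
  rw [Measure.integral_comp_mul_left, abs_of_pos (inv_pos.2 hε), smul_eq_mul]
  field_simp

/-- Near an endpoint, the integrals of the AM-GM gap of a density and its translate are
asymptotic to the power of the translation given by the pure power. -/
lemma tendsto_integral_amgmGap_near {g : ℝ → ℝ} {α A C D : ℝ} (hα0 : 0 < α) (hα1 : α < 1)
    (hA : 0 < A) (hC : 0 ≤ C) (hD : 0 < D) (hm : Measurable g) (hnn : ∀ x, 0 ≤ g x)
    (h0 : ∀ x ≤ 0, g x = 0) (hlim : Tendsto (fun x => g x / x ^ α) (𝓝[>] 0) (𝓝 A))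
    (hpl : IsPowerLikeNearZero (fun x => √(g x)) α C D) :
    Tendsto (fun i : ℝ × ℝ => (∫ x, {x | x + i.1 < D}.indicator
        (fun x => amgmGap i.2 (g (x + i.1)) (g x)) x) / i.1 ^ (1 + α) - A * powerRate α i.2)
      (𝓝[>] 0 ×ˢ 𝓟 (Ioo 0 1)) (𝓝 0) := by
  -- The limiting integrand depends on s as well, so dominated convergence is applied to the
  -- difference, with limit 0.
  set F : ℝ × ℝ → ℝ → ℝ := fun i u => {u | i.1 * (u + 1) < D}.indicator
    (fun u => amgmGap i.2 (g (i.1 * (u + 1)) / i.1 ^ α) (g (i.1 * u) / i.1 ^ α)) u -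
      amgmGap i.2 (A * posPow α (u + 1)) (A * posPow α u) with hF
  have hev := eventually_prod_principal_Ioo
  have hmeasG : ∀ i : ℝ × ℝ, Measurable ({u | i.1 * (u + 1) < D}.indicator
      (fun u => amgmGap i.2 (g (i.1 * (u + 1)) / i.1 ^ α) (g (i.1 * u) / i.1 ^ α))) := fun i =>
    (measurable_amgmGap ((hm.comp (by fun_prop)).div_const _)
      ((hm.comp (by fun_prop)).div_const _)).indicator
      (measurableSet_lt (by fun_prop) measurable_const)
  have hbound1 : ∀ i : ℝ × ℝ, 0 < i.1 → i.2 ∈ Ioo (0 : ℝ) 1 → ∀ u,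
      ‖{u | i.1 * (u + 1) < D}.indicator
        (fun u => amgmGap i.2 (g (i.1 * (u + 1)) / i.1 ^ α) (g (i.1 * u) / i.1 ^ α)) u‖ ≤
        C ^ 2 * incrementBound α u := by
    intro i hi hs u
    by_cases hu : i.1 * (u + 1) < D
    · rw [indicator_of_mem (show u ∈ {u | i.1 * (u + 1) < D} from hu)]
      have hε : 0 < i.1 ^ α := by positivity
      have e1 : ∀ y, g y / i.1 ^ α = (i.1 ^ α)⁻¹ * g y := fun y => by field_simp
      rw [e1, e1, amgmGap_mul (by positivity) (hnn _) (hnn _),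
        Real.norm_of_nonneg (mul_nonneg (by positivity) (amgmGap_nonneg hs (hnn _) (hnn _))),
        inv_mul_le_iff₀ hε]
      exact (amgmGap_le_sq_sqrt_sub hs (hnn _) (hnn _)).trans
        (hpl.sq_sub_le hα0 hα1 hC hi hu)
    · rw [indicator_of_notMem (show u ∉ {u | i.1 * (u + 1) < D} from hu), norm_zero]
      exact mul_nonneg (by positivity) (incrementBound_nonneg _ _)
  have hI1 : ∀ i : ℝ × ℝ, 0 < i.1 → i.2 ∈ Ioo (0 : ℝ) 1 →
      Integrable ({u | i.1 * (u + 1) < D}.indicator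
        (fun u => amgmGap i.2 (g (i.1 * (u + 1)) / i.1 ^ α) (g (i.1 * u) / i.1 ^ α))) :=
    fun i hi hs => ((integrable_incrementBound hα1).const_mul (C ^ 2)).mono'
      (hmeasG i).aestronglyMeasurable (ae_of_all _ (hbound1 i hi hs))
  have hgap : ∀ (s u : ℝ), amgmGap s (A * posPow α (u + 1)) (A * posPow α u) =
      A * amgmGap s (posPow α (u + 1)) (posPow α u) := fun s u =>
    amgmGap_mul hA.le (posPow_nonneg _ _) (posPow_nonneg _ _)
  have hI2 : ∀ s ∈ Ioo (0 : ℝ) 1,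
      Integrable fun u => amgmGap s (A * posPow α (u + 1)) (A * posPow α u) := fun s hs => by
    simp_rw [hgap]
    exact (integrable_amgmGap_posPow hα0 hα1 hs).const_mul A
  have key : Tendsto (fun i => ∫ u, F i u) (𝓝[>] 0 ×ˢ 𝓟 (Ioo 0 1)) (𝓝 (∫ _ : ℝ, (0 : ℝ))) := by
    refine tendsto_integral_filter_of_dominated_convergence
      (fun u => (C ^ 2 + A) * incrementBound α u) ?_ ?_ ?_ ?_
    · filter_upwards [hev] with i hi
      exact ((hI1 i hi.1 hi.2).sub (hI2 i.2 hi.2)).aestronglyMeasurable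
    · filter_upwards [hev] with i hi
      refine ae_of_all _ fun u => (norm_sub_le _ _).trans ?_
      rw [add_mul]
      refine add_le_add (hbound1 i hi.1 hi.2 u) ?_
      rw [hgap, Real.norm_of_nonneg (mul_nonneg hA.le
        (amgmGap_nonneg hi.2 (posPow_nonneg _ _) (posPow_nonneg _ _)))]
      exact mul_le_mul_of_nonneg_left ((amgmGap_le_sq_sqrt_sub hi.2 (posPow_nonneg _ _)
        (posPow_nonneg _ _)).trans (sq_sqrt_posPow_sub_le hα0 hα1 u)) hA.le
    · exact (integrable_incrementBound hα1).const_mul _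
    · refine ae_of_all _ fun u => ?_
      have hx : Tendsto (fun i : ℝ × ℝ => g (i.1 * (u + 1)) / i.1 ^ α)
          (𝓝[>] 0 ×ˢ 𝓟 (Ioo 0 1)) (𝓝 (A * posPow α (u + 1))) :=
        (tendsto_rescale hα0 h0 hlim (u + 1)).comp tendsto_fst
      have hy : Tendsto (fun i : ℝ × ℝ => g (i.1 * u) / i.1 ^ α)
          (𝓝[>] 0 ×ˢ 𝓟 (Ioo 0 1)) (𝓝 (A * posPow α u)) :=
        (tendsto_rescale hα0 h0 hlim u).comp tendsto_fst
      have hmem : ∀ᶠ i : ℝ × ℝ in 𝓝[>] 0 ×ˢ 𝓟 (Ioo 0 1), i.1 * (u + 1) < D := by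
        have h1 : Tendsto (fun ε : ℝ => ε * (u + 1)) (𝓝 0) (𝓝 (0 * (u + 1))) :=
          tendsto_id.mul_const _
        rw [zero_mul] at h1
        exact ((h1.mono_left nhdsWithin_le_nhds).comp
          (tendsto_fst (g := 𝓟 (Ioo (0 : ℝ) 1)))).eventually (gt_mem_nhds hD)
      have hlimG : Tendsto (fun i : ℝ × ℝ =>
          amgmGap i.2 (g (i.1 * (u + 1)) / i.1 ^ α) (g (i.1 * u) / i.1 ^ α) -
          amgmGap i.2 (A * posPow α (u + 1)) (A * posPow α u))
          (𝓝[>] 0 ×ˢ 𝓟 (Ioo 0 1)) (𝓝 0) := by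
        -- For u ≤ 0 the second argument is exactly 0 for every ε, and the gap is linear in the
        -- first; the comparison through ratios applies only for u > 0.
        rcases le_or_gt u 0 with hu | hu
        · rw [posPow_of_nonpos hα0 hu, mul_zero]
          refine (tendsto_amgmGap_zero_sub (hev.mono fun i hi => hi.2) hx).congr' ?_
          filter_upwards [hev] with i hi
          rw [h0 (i.1 * u) (mul_nonpos_of_nonneg_of_nonpos hi.1.le hu), zero_div]
        · have hp : ∀ v, 0 < v → 0 < A * posPow α v := fun v hv => by
            rw [posPow_of_nonneg hv.le]; positivity
          exact tendsto_amgmGap_sub (hev.mono fun i hi => hi.2) hx hy (hp _ (by linarith)) (hp _ hu)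
      refine hlimG.congr' ?_
      filter_upwards [hmem] with i hi
      simp only [hF]
      rw [indicator_of_mem (show u ∈ {u | i.1 * (u + 1) < D} from hi)]
  rw [integral_zero] at key
  refine key.congr' ?_
  filter_upwards [hev] with i hi
  have hε : 0 < i.1 ^ α := Real.rpow_pos_of_pos hi.1 α
  simp only [hF]
  rw [integral_sub (hI1 i hi.1 hi.2) (hI2 _ hi.2)]
  congr 1
  · symm
    rw [integral_rescale _ hi.1, Real.rpow_add hi.1, Real.rpow_one, mul_div_mul_left _ _ hi.1.ne',
      ← integral_div]
    congr 1
    ext u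
    have e : i.1 * u + i.1 = i.1 * (u + 1) := by ring
    have e1 : ∀ y, g y / i.1 ^ α = (i.1 ^ α)⁻¹ * g y := fun y => by field_simp
    simp only [indicator, mem_ofPred_eq, e]
    split_ifs
    · rw [e1, e1, amgmGap_mul (by positivity) (hnn _) (hnn _)]; field_simp
    · simp
  · simp_rw [hgap]
    rw [integral_const_mul, powerRate]

/-- Near an endpoint where the coefficient vanishes, the Hellinger integrals are negligible. -/
lemma tendsto_integral_sq_sqrt_sub_near {g : ℝ → ℝ} {α C D : ℝ} (hα0 : 0 < α) (hα1 : α < 1)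
    (hC : 0 ≤ C) (hm : Measurable g)
    (h0 : ∀ x ≤ 0, g x = 0) (hlim : Tendsto (fun x => g x / x ^ α) (𝓝[>] 0) (𝓝 0))
    (hpl : IsPowerLikeNearZero (fun x => √(g x)) α C D) :
    Tendsto (fun ε : ℝ => (∫ x, {x | x + ε < D}.indicator
        (fun x => (√(g (x + ε)) - √(g x)) ^ 2) x) / ε ^ (1 + α)) (𝓝[>] 0) (𝓝 0) := by
  set F : ℝ → ℝ → ℝ := fun ε u => {u | ε * (u + 1) < D}.indicator
    (fun u => (√(g (ε * (u + 1))) - √(g (ε * u))) ^ 2 / ε ^ α) u with hF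
  have key : Tendsto (fun ε => ∫ u, F ε u) (𝓝[>] 0) (𝓝 (∫ _ : ℝ, (0 : ℝ))) := by
    refine tendsto_integral_filter_of_dominated_convergence
      (fun u => C ^ 2 * incrementBound α u) ?_ ?_ ?_ ?_
    · refine Eventually.of_forall fun ε => Measurable.aestronglyMeasurable ?_
      refine Measurable.indicator ?_ (measurableSet_lt (by fun_prop) measurable_const)
      exact (((hm.comp (by fun_prop)).sqrt.sub (hm.comp (by fun_prop)).sqrt).pow_const 2).div_const _
    · filter_upwards [self_mem_nhdsWithin] with ε hε
      have hε' : (0 : ℝ) < ε := hε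
      refine ae_of_all _ fun u => ?_
      simp only [hF]
      by_cases hu : ε * (u + 1) < D
      · rw [indicator_of_mem (show u ∈ {u | ε * (u + 1) < D} from hu),
          Real.norm_of_nonneg (by positivity), div_le_iff₀ (by positivity), mul_comm (C ^ 2 * _)]
        exact hpl.sq_sub_le hα0 hα1 hC hε hu
      · rw [indicator_of_notMem (show u ∉ {u | ε * (u + 1) < D} from hu), norm_zero]
        exact mul_nonneg (by positivity) (incrementBound_nonneg _ _)
    · exact (integrable_incrementBound hα1).const_mul _
    · refine ae_of_all _ fun u => ?_
      have hx := (tendsto_rescale hα0 h0 hlim (u + 1)).sqrt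
      have hy := (tendsto_rescale hα0 h0 hlim u).sqrt
      have hl := (hx.sub hy).pow 2
      simp only [zero_mul, Real.sqrt_zero, sub_zero, zero_pow two_ne_zero] at hl
      refine squeeze_zero_norm' ?_ hl
      filter_upwards [self_mem_nhdsWithin] with ε hε
      have hε' : (0 : ℝ) < ε := hε
      simp only [hF]
      refine (norm_indicator_le_norm_self _ _).trans ?_
      rw [Real.norm_of_nonneg (by positivity), Real.sqrt_div' _ (by positivity),
        Real.sqrt_div' _ (by positivity), ← sub_div, div_pow, Real.sq_sqrt (by positivity)]
  rw [integral_zero] at key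
  refine key.congr' ?_
  filter_upwards [self_mem_nhdsWithin] with ε hε
  have hε' : (0 : ℝ) < ε := hε
  symm
  rw [integral_rescale _ hε', Real.rpow_add hε', Real.rpow_one, mul_div_mul_left _ _ hε'.ne',
      ← integral_div]
  congr 1
  ext u
  have e : ε * u + ε = ε * (u + 1) := by ring
  simp only [hF, indicator, mem_ofPred_eq, e]
  split_ifs <;> simp

/-! ### The deficit between the density and its translate -/

section Density

variable {f : ℝ → ℝ} {a : ℝ} {b : EReal}

lemma isOpen_support (a : ℝ) (b : EReal) : IsOpen {x : ℝ | a < x ∧ (x : EReal) < b} :=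
  (isOpen_lt continuous_const continuous_id).inter
    (isOpen_lt continuous_coe_real_ereal continuous_const)

namespace IsIntervalDensity

lemma nonneg (hf : IsIntervalDensity f a b) (x : ℝ) : 0 ≤ f x := by
  by_cases hx : a < x ∧ (x : EReal) < b
  · exact (hf.pos x hx.1 hx.2).le
  · exact (hf.eq_zero x hx).ge

lemma measurable (hf : IsIntervalDensity f a b) : Measurable f := by
  classical
  have h : f = {x : ℝ | a < x ∧ (x : EReal) < b}.piecewise f 0 := by
    ext x
    by_cases hx : x ∈ {x : ℝ | a < x ∧ (x : EReal) < b}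
    · rw [piecewise_eq_of_mem _ _ _ hx]
    · rw [piecewise_eq_of_notMem _ _ _ hx, hf.eq_zero x hx]; rfl
  rw [h]
  exact hf.contDiffOn.continuousOn.measurable_piecewise continuousOn_const
    (isOpen_support a b).measurableSet

lemma integrable (hf : IsIntervalDensity f a b) : Integrable f := by
  refine ⟨hf.measurable.aestronglyMeasurable, ?_⟩
  rw [hasFiniteIntegral_iff_ofReal (ae_of_all _ hf.nonneg), hf.lintegral_eq_one]
  exact ENNReal.one_lt_top

lemma integral_eq_one (hf : IsIntervalDensity f a b) : ∫ x, f x = 1 := by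
  rw [integral_eq_lintegral_of_nonneg_ae (ae_of_all _ hf.nonneg)
    hf.measurable.aestronglyMeasurable, hf.lintegral_eq_one, ENNReal.toReal_one]

lemma lt (hf : IsIntervalDensity f a b) : (a : EReal) < b := by
  by_contra hcon
  have h : f = 0 := by
    ext x
    refine hf.eq_zero x fun hx => hcon ?_
    exact (EReal.coe_lt_coe_iff.2 hx.1).trans hx.2
  have := hf.integral_eq_one
  simp [h] at this

lemma differentiableAt (hf : IsIntervalDensity f a b) {x : ℝ} (h1 : a < x)
    (h2 : (x : EReal) < b) : DifferentiableAt ℝ f x :=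
  (hf.contDiffOn.differentiableOn one_ne_zero).differentiableAt
    ((isOpen_support a b).mem_nhds ⟨h1, h2⟩)

lemma exists_deriv_bound (hf : IsIntervalDensity f a b) {c d : ℝ} (hc : a < c)
    (hd : (d : EReal) < b) : ∃ m, 0 ≤ m ∧ ∀ x ∈ Icc c d, deriv f x ^ 2 / f x ≤ m ^ 2 := by
  have hsub : Icc c d ⊆ {x : ℝ | a < x ∧ (x : EReal) < b} := fun x hx =>
    ⟨hc.trans_le hx.1, (EReal.coe_le_coe_iff.2 hx.2).trans_lt hd⟩
  have hc1 : ContinuousOn (deriv f) (Icc c d) :=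
    (hf.contDiffOn.continuousOn_deriv_of_isOpen (isOpen_support a b) le_rfl).mono hsub
  have hc2 : ContinuousOn (fun x => deriv f x ^ 2 / f x) (Icc c d) :=
    (hc1.pow 2).div (hf.contDiffOn.continuousOn.mono hsub) fun x hx =>
      (hf.pos x (hsub hx).1 (hsub hx).2).ne'
  obtain ⟨M, hM⟩ := isCompact_Icc.bddAbove_image hc2
  refine ⟨√|M|, Real.sqrt_nonneg _, fun x hx => ?_⟩
  rw [Real.sq_sqrt (abs_nonneg _)]
  exact (hM (mem_image_of_mem _ hx)).trans (le_abs_self _)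

lemma integrable_sq_sqrt_sub (hf : IsIntervalDensity f a b) (ε : ℝ) :
    Integrable fun x => (√(f (x + ε)) - √(f x)) ^ 2 := by
  refine ((hf.integrable.comp_add_right ε).add hf.integrable).mono' ?_ (ae_of_all _ fun x => ?_)
  · exact (((hf.measurable.comp (measurable_add_const ε)).sqrt.sub
      hf.measurable.sqrt).pow_const 2).aestronglyMeasurable
  · rw [Real.norm_of_nonneg (sq_nonneg _)]
    exact sq_sqrt_sub_le_add (hf.nonneg _) (hf.nonneg _)

lemma integrable_amgmGap (hf : IsIntervalDensity f a b) {s : ℝ} (hs : s ∈ Ioo (0 : ℝ) 1) (ε : ℝ) :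
    Integrable fun x => amgmGap s (f (x + ε)) (f x) := by
  refine (hf.integrable_sq_sqrt_sub ε).mono' (measurable_amgmGap
    (hf.measurable.comp (measurable_add_const ε)) hf.measurable).aestronglyMeasurable
    (ae_of_all _ fun x => ?_)
  rw [Real.norm_of_nonneg (amgmGap_nonneg hs (hf.nonneg _) (hf.nonneg _))]
  exact amgmGap_le_sq_sqrt_sub hs (hf.nonneg _) (hf.nonneg _)

lemma exists_isPowerLike_left (hf : IsIntervalDensity f a b) {κ A : ℝ} (hκ : κ < 2)
    (hl : LeftEndpoint f a κ A) :
    ∃ C D, 0 ≤ C ∧ 0 < D ∧ IsPowerLikeNearZero (fun x => √(f (a + x))) (κ - 1) C D := by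
  obtain ⟨c, hac, hcb⟩ := EReal.lt_iff_exists_real_btwn.1 hf.lt
  have hac : a < c := EReal.coe_lt_coe_iff.1 hac
  have hmap := tendsto_const_add_nhdsGT a
  have hin : ∀ x : ℝ, x < c - a → ((a + x : ℝ) : EReal) < b := fun x hx =>
    (EReal.coe_lt_coe_iff.2 (by linarith)).trans hcb
  obtain ⟨C, D, hC, hD, -, h⟩ := exists_isPowerLikeNearZero (g := fun x => f (a + x)) (α := κ - 1)
    (A := A) (D₀ := c - a) (by linarith) (sub_pos.2 hac)
    (fun x hx => hf.eq_zero _ fun h => by linarith [h.1])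
    (fun x hx hxD => hf.pos _ (by linarith) (hin x hxD))
    (fun x hx hxD => (hf.differentiableAt (by linarith) (hin x hxD)).comp x
      ((differentiableAt_const a).add differentiableAt_id))
    (by simpa [Function.comp_def] using hl.tendsto.comp hmap)
    (by
      have := hl.deriv_isBigO.comp_tendsto hmap
      refine (this.congr_left fun x => ?_).congr_right fun x => ?_
      · simp only [Function.comp, deriv_comp_const_add]
      · simp only [Function.comp]
        congr 1 <;> ring)
  exact ⟨C, D, hC, hD, h⟩

lemma exists_isPowerLike_right {r : ℝ} (hf : IsIntervalDensity f a r) {κ : ℝ} (hκ : κ < 2)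
    (hr : NegligibleRightEndpoint f r κ) :
    Tendsto (fun x => f (r - x) / x ^ (κ - 1)) (𝓝[>] 0) (𝓝 0) ∧
    ∃ C D, 0 ≤ C ∧ 0 < D ∧ D ≤ r - a ∧
      IsPowerLikeNearZero (fun x => √(f (r - x))) (κ - 1) C D := by
  have har : a < r := EReal.coe_lt_coe_iff.1 hf.lt
  have hmap : Tendsto (fun x : ℝ => r - x) (𝓝[>] 0) (𝓝[<] r) := by
    refine tendsto_nhdsWithin_iff.2 ⟨?_, ?_⟩
    · have : Tendsto (fun x : ℝ => r - x) (𝓝 0) (𝓝 (r - 0)) := tendsto_const_nhds.sub tendsto_id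
      rw [sub_zero] at this
      exact this.mono_left nhdsWithin_le_nhds
    · filter_upwards [self_mem_nhdsWithin] with x hx
      have : (0 : ℝ) < x := hx
      simpa using this
  have hin : ∀ x : ℝ, 0 < x → ((r - x : ℝ) : EReal) < r := fun x hx =>
    EReal.coe_lt_coe_iff.2 (by linarith)
  have hlim : Tendsto (fun x => f (r - x) / x ^ (κ - 1)) (𝓝[>] 0) (𝓝 0) := by
    simpa [Function.comp_def] using (hr.finite_tendsto r rfl).comp hmap
  refine ⟨hlim, ?_⟩
  obtain ⟨C, D, hC, hD, hDr, h⟩ := exists_isPowerLikeNearZero (g := fun x => f (r - x))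
    (α := κ - 1) (A := 0) (D₀ := r - a) (by linarith) (sub_pos.2 har)
    (fun x hx => hf.eq_zero _ fun h => by
      have := EReal.coe_lt_coe_iff.1 h.2
      linarith)
    (fun x hx hxD => hf.pos _ (by linarith) (hin x hx))
    (fun x hx hxD => (hf.differentiableAt (by linarith) (hin x hx)).comp x
      ((differentiableAt_const r).sub differentiableAt_id)) hlim
    (by
      have := (hr.finite_deriv_isLittleO r rfl).isBigO.comp_tendsto hmap
      refine (this.congr_left fun x => ?_).congr_right fun x => ?_
      · simp only [Function.comp, deriv_comp_const_sub, neg_sq]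
      · simp only [Function.comp]
        congr 1 <;> ring)
  exact ⟨C, D, hC, hD, hDr, h⟩

/-- A bounded interval with increments O(ε) contributes O(ε²), which is o(ε^κ) since κ < 2. The
family R stands for the part near b or at infinity. -/
lemma tendsto_hellinger_of_bound (hf : IsIntervalDensity f a b) {κ c d m D : ℝ} (hκ : κ < 2)
    {R : ℝ → ℝ → ℝ} (hR : ∀ᶠ ε in 𝓝[>] (0 : ℝ), Integrable (R ε))
    (hlim : Tendsto (fun ε => (∫ x, R ε x) / ε ^ κ) (𝓝[>] 0) (𝓝 0))
    (hb : ∀ᶠ ε in 𝓝[>] (0 : ℝ), ∀ x, a + D ≤ x + ε →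
      (√(f (x + ε)) - √(f x)) ^ 2 ≤ (Icc c d).indicator (fun _ => m ^ 2 * ε ^ 2) x + R ε x)
    (hR0 : ∀ᶠ ε in 𝓝[>] (0 : ℝ), ∀ x, 0 ≤ R ε x) :
    Tendsto (fun ε => (∫ x, {x | a + D ≤ x + ε}.indicator
      (fun x => (√(f (x + ε)) - √(f x)) ^ 2) x) / ε ^ κ) (𝓝[>] 0) (𝓝 0) := by
  have hsq := tendsto_rpow_nhdsGT_zero (p := 2 - κ) (by linarith)
  have hup := (hsq.const_mul (m ^ 2 * volume.real (Icc c d))).add hlim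
  rw [mul_zero, add_zero] at hup
  refine squeeze_zero' ?_ ?_ hup
  · filter_upwards [self_mem_nhdsWithin] with ε hε
    have hε' : (0 : ℝ) < ε := hε
    exact div_nonneg (integral_nonneg fun x => indicator_nonneg (fun _ _ => sq_nonneg _) _)
      (by positivity)
  · filter_upwards [self_mem_nhdsWithin, hR, hb, hR0] with ε hε hRε hbε hR0ε
    have hε' : (0 : ℝ) < ε := hε
    have hI : Integrable ((Icc c d).indicator fun _ : ℝ => m ^ 2 * ε ^ 2) :=
      (integrable_indicator_iff measurableSet_Icc).2 continuousOn_const.integrableOn_Icc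
    have h1 : ∫ x, {x | a + D ≤ x + ε}.indicator (fun x => (√(f (x + ε)) - √(f x)) ^ 2) x ≤
        ∫ x, ((Icc c d).indicator (fun _ => m ^ 2 * ε ^ 2) x + R ε x) := by
      refine integral_mono ((hf.integrable_sq_sqrt_sub ε).indicator
        (measurableSet_le measurable_const (by fun_prop))) (hI.add hRε) fun x => ?_
      refine indicator_le' (fun x hx => hbε x hx) (fun x _ => ?_) x
      exact add_nonneg (indicator_nonneg (fun _ _ => by positivity) _) (hR0ε x)
    rw [integral_add hI hRε, integral_indicator measurableSet_Icc, setIntegral_const,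
      smul_eq_mul] at h1
    have h2 : ε ^ (2 - κ) = ε ^ 2 / ε ^ κ := by
      rw [Real.rpow_sub hε']; norm_num
    rw [h2]
    calc _ ≤ (volume.real (Icc c d) * (m ^ 2 * ε ^ 2) + ∫ x, R ε x) / ε ^ κ := by gcongr
      _ = _ := by ring

lemma sq_sqrt_sub_le_of_deriv_bound (hf : IsIntervalDensity f a b) {c d m x ε : ℝ} (hc : a < c)
    (hd : (d : EReal) < b) (hm : 0 ≤ m) (hb : ∀ x ∈ Icc c d, deriv f x ^ 2 / f x ≤ m ^ 2)
    (hε : 0 ≤ ε) (hx : c ≤ x) (hxd : x + ε ≤ d) :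
    (√(f (x + ε)) - √(f x)) ^ 2 ≤ m ^ 2 * ε ^ 2 := by
  have hsub : Icc x (x + ε) ⊆ Icc c d := Icc_subset_Icc hx hxd
  have hlt : ∀ z ∈ Icc c d, a < z ∧ (z : EReal) < b := fun z hz =>
    ⟨hc.trans_le hz.1, (EReal.coe_le_coe_iff.2 hz.2).trans_lt hd⟩
  have := abs_sqrt_sub_sqrt_le (g := f) (x := x) (y := x + ε) (m := m) (by linarith)
    (fun z hz => hf.pos z (hlt z (hsub hz)).1 (hlt z (hsub hz)).2)
    (fun z hz => hf.differentiableAt (hlt z (hsub hz)).1 (hlt z (hsub hz)).2) hm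
    (fun z hz => hb z (hsub hz))
  rw [add_sub_cancel_left] at this
  rw [← sq_abs, ← mul_pow]
  gcongr

lemma tendsto_hellinger_right_finite {r : ℝ} (hf : IsIntervalDensity f a r) {κ D : ℝ}
    (hκ1 : 1 < κ) (hκ : κ < 2) (hr : NegligibleRightEndpoint f r κ) (hD : 0 < D) :
    Tendsto (fun ε => (∫ x, {x | a + D ≤ x + ε}.indicator
      (fun x => (√(f (x + ε)) - √(f x)) ^ 2) x) / ε ^ κ) (𝓝[>] 0) (𝓝 0) := by
  obtain ⟨hlim, C, E, hC, hE, hEr, hpl⟩ := hf.exists_isPowerLike_right hκ hr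
  obtain ⟨m, hm, hmb⟩ := hf.exists_deriv_bound (c := a + D / 2) (d := r - E / 2) (by linarith)
    (EReal.coe_lt_coe_iff.2 (by linarith))
  set G : ℝ → ℝ → ℝ := fun ε x => {x | x + ε < E}.indicator
    (fun x => (√(f (r - (x + ε))) - √(f (r - x))) ^ 2) x with hG
  have hGlim := tendsto_integral_sq_sqrt_sub_near (g := fun x => f (r - x)) (α := κ - 1)
    (by linarith) (by linarith) hC (hf.measurable.comp (by fun_prop))
    (fun x hx => hf.eq_zero _ fun h => by
      have := EReal.coe_lt_coe_iff.1 h.2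
      linarith) hlim hpl
  have hGint : ∀ ε, Integrable (G ε) := fun ε => by
    refine Integrable.indicator ?_ (measurableSet_lt (by fun_prop) measurable_const)
    have := (hf.integrable_sq_sqrt_sub (-ε)).comp_sub_left r
    refine this.congr (ae_of_all _ fun x => ?_)
    simp only
    rw [show r - (x + ε) = r - x + -ε by ring]
  -- The reflection x ↦ r - ε - x swaps the points x and x + ε seen from r, so the estimate at a
  -- left endpoint applies at b.
  have hGrefl : ∀ ε, ∫ x, G ε (r - ε - x) = ∫ x, G ε x := fun ε =>
    integral_sub_left_eq_self (G ε) volume (r - ε)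
  refine hf.tendsto_hellinger_of_bound (c := a + D / 2) (d := r) (m := m) hκ
    (R := fun ε x => G ε (r - ε - x)) (Eventually.of_forall fun ε => (hGint ε).comp_sub_left _)
    ?_ ?_ ?_
  · simp_rw [hGrefl]
    rw [show κ = 1 + (κ - 1) by ring]
    exact hGlim
  · filter_upwards [self_mem_nhdsWithin, mem_nhdsWithin_of_mem_nhds (Iio_mem_nhds (half_pos hD)),
      mem_nhdsWithin_of_mem_nhds (Iio_mem_nhds (half_pos hE))] with ε hε hεD hεE x hx
    have hε : 0 < ε := hε
    have hεD : ε < D / 2 := hεD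
    have hεE : ε < E / 2 := hεE
    have hxc : a + D / 2 ≤ x := by linarith
    by_cases hxr : r - x < E
    · have e : G ε (r - ε - x) = (√(f (x + ε)) - √(f x)) ^ 2 := by
        rw [hG]
        simp only
        rw [indicator_of_mem (show r - ε - x ∈ {x | x + ε < E} by
          simp only [mem_ofPred_eq]; linarith), ← neg_sq]
        ring_nf
      rw [e]
      exact le_add_of_nonneg_left (indicator_nonneg (fun _ _ => by positivity) _)
    · rw [not_lt] at hxr
      rw [indicator_of_mem (show x ∈ Icc (a + D / 2) r from ⟨hxc, by linarith⟩)]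
      refine (hf.sq_sqrt_sub_le_of_deriv_bound (c := a + D / 2) (d := r - E / 2) (by linarith)
        (EReal.coe_lt_coe_iff.2 (by linarith)) hm hmb hε.le hxc (by linarith)).trans ?_
      exact le_add_of_nonneg_right (indicator_nonneg (fun _ _ => sq_nonneg _) _)
  · exact Eventually.of_forall fun ε x => indicator_nonneg (fun _ _ => sq_nonneg _) _

lemma tendsto_hellinger_right_infinite (hf : IsIntervalDensity f a ⊤) {κ D : ℝ}
    (hκ : κ < 2) (hr : NegligibleRightEndpoint f ⊤ κ) (hD : 0 < D) :
    Tendsto (fun ε => (∫ x, {x | a + D ≤ x + ε}.indicator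
      (fun x => (√(f (x + ε)) - √(f x)) ^ 2) x) / ε ^ κ) (𝓝[>] 0) (𝓝 0) := by
  obtain ⟨c, hc⟩ := (hr.infinite_deriv_isBigO rfl).bound
  obtain ⟨X₀, hX₀⟩ := eventually_atTop.1 hc
  set X := max X₀ (a + 1)
  have haX : a < X := (lt_add_one a).trans_le (le_max_right _ _)
  obtain ⟨m, hm, hmb⟩ := hf.exists_deriv_bound (c := a + D / 2) (d := X + 1) (by linarith)
    (EReal.coe_lt_top _)
  have hc0 : 0 ≤ |c| := abs_nonneg c
  -- A bounded logarithmic derivative gives √f(x + ε) = √f(x) exp τ with |τ| ≤ |c|ε/2, hence |exp τ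
  -- - 1| ≤ |c|ε. The resulting bound is a multiple of ε² f(x), whose integral is O(ε²).
  have htail : ∀ x ε, X ≤ x → 0 < ε → |c| * ε ≤ 1 →
      (√(f (x + ε)) - √(f x)) ^ 2 ≤ |c| ^ 2 * ε ^ 2 * f x := by
    intro x ε hx hε hcε
    have hp : ∀ z, X ≤ z → 0 < f z := fun z hz => hf.pos z (by linarith) (EReal.coe_lt_top _)
    have hmv := (convex_Icc x (x + ε)).norm_image_sub_le_of_norm_hasDerivWithin_le
      (f := fun z => Real.log (f z)) (f' := fun z => deriv f z / f z) (C := |c|)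
      (fun z hz => ((hf.differentiableAt (haX.trans_le (hx.trans hz.1))
        (EReal.coe_lt_top _)).hasDerivAt.log (hp z (hx.trans hz.1)).ne').hasDerivWithinAt)
      (fun z hz => by
        have h1 := hX₀ z ((le_max_left _ _).trans (hx.trans hz.1))
        have h2 := hp z (hx.trans hz.1)
        rw [norm_div, div_le_iff₀ (norm_pos_iff.2 h2.ne')]
        exact h1.trans (mul_le_mul_of_nonneg_right (le_abs_self c) (norm_nonneg _)))
      (left_mem_Icc.2 (by linarith)) (right_mem_Icc.2 (by linarith))
    have h1 := hp x hx
    have h2 := hp (x + ε) (by linarith)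
    rw [add_sub_cancel_left, Real.norm_of_nonneg hε.le, Real.norm_eq_abs] at hmv
    set τ := (Real.log (f (x + ε)) - Real.log (f x)) / 2 with hτ
    have hτ' : |τ| ≤ |c| * ε / 2 := by
      rw [hτ, abs_div, abs_two]; linarith
    have e : √(f (x + ε)) = √(f x) * Real.exp τ := by
      have : f (x + ε) = f x * Real.exp τ ^ 2 := by
        rw [← Real.exp_nat_mul, hτ]
        push_cast
        rw [mul_div_cancel₀ _ two_ne_zero, Real.exp_sub, Real.exp_log h1, Real.exp_log h2]
        field_simp
      rw [this, Real.sqrt_mul h1.le, Real.sqrt_sq (Real.exp_pos _).le]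
    have he : |Real.exp τ - 1| ≤ |c| * ε :=
      (Real.abs_exp_sub_one_le (by linarith)).trans (by linarith)
    have : (√(f (x + ε)) - √(f x)) ^ 2 = |Real.exp τ - 1| ^ 2 * f x := by
      rw [e, sq_abs, ← mul_sub_one, mul_pow, Real.sq_sqrt h1.le, mul_comm]
    rw [this, ← mul_pow]
    gcongr
  refine hf.tendsto_hellinger_of_bound (c := a + D / 2) (d := X) (m := m) hκ
    (R := fun ε x => |c| ^ 2 * ε ^ 2 * f x)
    (Eventually.of_forall fun ε => hf.integrable.const_mul _) ?_ ?_ ?_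
  · have hsq := tendsto_rpow_nhdsGT_zero (p := 2 - κ) (by linarith)
    have := hsq.const_mul (|c| ^ 2)
    rw [mul_zero] at this
    refine this.congr' ?_
    filter_upwards [self_mem_nhdsWithin] with ε hε
    have hε' : (0 : ℝ) < ε := hε
    rw [integral_const_mul, hf.integral_eq_one, Real.rpow_sub hε']
    norm_num
    ring
  · have hcev : ∀ᶠ ε in 𝓝[>] (0 : ℝ), |c| * ε < 1 := by
      have h : Tendsto (fun ε : ℝ => |c| * ε) (𝓝 0) (𝓝 (|c| * 0)) := tendsto_id.const_mul _
      rw [mul_zero] at h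
      exact (h.mono_left nhdsWithin_le_nhds).eventually (gt_mem_nhds one_pos)
    filter_upwards [self_mem_nhdsWithin, mem_nhdsWithin_of_mem_nhds (Iio_mem_nhds (half_pos hD)),
      mem_nhdsWithin_of_mem_nhds (Iio_mem_nhds one_pos), hcev] with ε hε hεD hε1 hcε x hx
    have hε : 0 < ε := hε
    have hεD : ε < D / 2 := hεD
    have hε1 : ε < 1 := hε1
    have hxc : a + D / 2 ≤ x := by linarith
    rcases le_or_gt X x with hxX | hxX
    · exact (htail x ε hxX hε hcε.le).trans
        (le_add_of_nonneg_left (indicator_nonneg (fun _ _ => by positivity) _))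
    · rw [indicator_of_mem (show x ∈ Icc (a + D / 2) X from ⟨hxc, hxX.le⟩)]
      refine (hf.sq_sqrt_sub_le_of_deriv_bound (c := a + D / 2) (d := X + 1) (by linarith)
        (EReal.coe_lt_top _) hm hmb hε.le hxc (by linarith)).trans ?_
      have := hf.nonneg x
      exact le_add_of_nonneg_right (by positivity)
  · refine Eventually.of_forall fun ε x => ?_
    have := hf.nonneg x
    positivity

lemma tendsto_hellinger_right (hf : IsIntervalDensity f a b) {κ D : ℝ} (hκ1 : 1 < κ)
    (hκ : κ < 2) (hr : NegligibleRightEndpoint f b κ) (hD : 0 < D) :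
    Tendsto (fun ε => (∫ x, {x | a + D ≤ x + ε}.indicator
      (fun x => (√(f (x + ε)) - √(f x)) ^ 2) x) / ε ^ κ) (𝓝[>] 0) (𝓝 0) := by
  induction b with
  | bot => exact absurd hf.lt (by simp)
  | coe r => exact hf.tendsto_hellinger_right_finite hκ1 hκ hr hD
  | top => exact hf.tendsto_hellinger_right_infinite hκ hr hD

/-- The deficit `1 - ∫ f(x + ε) ^ s f(x) ^ (1 - s)` is asymptotic to `A ε ^ κ` times the rate of
the pure power, uniformly in `s`. -/
lemma tendsto_integral_amgmGap (hf : IsIntervalDensity f a b) {κ A : ℝ} (hκ1 : 1 < κ)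
    (hκ : κ < 2) (hA : 0 < A) (hl : LeftEndpoint f a κ A) (hr : NegligibleRightEndpoint f b κ) :
    Tendsto (fun i : ℝ × ℝ => (∫ x, amgmGap i.2 (f (x + i.1)) (f x)) / i.1 ^ κ -
      A * powerRate (κ - 1) i.2) (𝓝[>] 0 ×ˢ 𝓟 (Ioo 0 1)) (𝓝 0) := by
  obtain ⟨C, D, hC, hD, hpl⟩ := hf.exists_isPowerLike_left hκ hl
  have hmap := tendsto_const_add_nhdsGT a
  have h1 := tendsto_integral_amgmGap_near (g := fun x => f (a + x)) (α := κ - 1) (A := A)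
    (by linarith) (by linarith) hA hC hD (hf.measurable.comp (by fun_prop))
    (fun x => hf.nonneg _) (fun x hx => hf.eq_zero _ fun h => by linarith [h.1])
    (by simpa [Function.comp_def] using hl.tendsto.comp hmap) hpl
  have h2 : Tendsto (fun i : ℝ × ℝ => (∫ x, {x | a + D ≤ x + i.1}.indicator
      (fun x => amgmGap i.2 (f (x + i.1)) (f x)) x) / i.1 ^ κ)
      (𝓝[>] 0 ×ˢ 𝓟 (Ioo 0 1)) (𝓝 0) := by
    have hH := (hf.tendsto_hellinger_right hκ1 hκ hr hD).comp
      (tendsto_fst (g := 𝓟 (Ioo (0 : ℝ) 1)))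
    have hev := eventually_prod_principal_Ioo
    have hms : ∀ ε : ℝ, MeasurableSet {x | a + D ≤ x + ε} := fun ε =>
      measurableSet_le measurable_const (by fun_prop)
    refine squeeze_zero' ?_ ?_ hH
    · filter_upwards [hev] with i hi
      exact div_nonneg (integral_nonneg fun x => indicator_nonneg
        (fun _ _ => amgmGap_nonneg hi.2 (hf.nonneg _) (hf.nonneg _)) _)
        (Real.rpow_nonneg hi.1.le _)
    · filter_upwards [hev] with i hi
      refine div_le_div_of_nonneg_right ?_ (Real.rpow_nonneg hi.1.le _)
      refine integral_mono ((hf.integrable_amgmGap hi.2 _).indicator (hms _))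
        ((hf.integrable_sq_sqrt_sub _).indicator (hms _)) fun x => ?_
      exact indicator_le_indicator (amgmGap_le_sq_sqrt_sub hi.2 (hf.nonneg _) (hf.nonneg _))
  have h3 := h1.add h2
  rw [add_zero] at h3
  refine h3.congr' ?_
  have hev := eventually_prod_principal_Ioo
  filter_upwards [hev] with i hi
  have hI := hf.integrable_amgmGap hi.2 i.1
  have hms : MeasurableSet {x | a + D ≤ x + i.1} := measurableSet_le measurable_const (by fun_prop)
  -- The cut is made at x + ε = a + D, so the near-endpoint part, translated by a, is the complement
  -- of the set in the Hellinger estimate.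
  have e1 : ∫ x, {x | x + i.1 < D}.indicator
      (fun x => amgmGap i.2 (f (a + (x + i.1))) (f (a + x))) x =
      ∫ x, {x | a + D ≤ x + i.1}ᶜ.indicator (fun x => amgmGap i.2 (f (x + i.1)) (f x)) x := by
    symm
    rw [← integral_add_left_eq_self _ a]
    congr 1
    ext x
    simp only [indicator, mem_compl_iff, mem_ofPred_eq, not_le, add_assoc, add_lt_add_iff_left]
  have e2 := integral_add_compl hms hI
  rw [e1, integral_indicator hms, integral_indicator hms.compl, ← e2, show 1 + (κ - 1) = κ by ring]
  ring

end IsIntervalDensity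

end Density

/-! ### Uniform limits of the Rényi entropies -/

/-- The Rényi entropy of order `s` between `f` and its translate by `ε`, as a real number. -/
noncomputable def shiftEntropy (f : ℝ → ℝ) (s ε : ℝ) : ℝ :=
  -Real.log (1 - ∫ x, amgmGap s (f (x + ε)) (f x))

namespace IsIntervalDensity

variable {f : ℝ → ℝ} {a : ℝ} {b : EReal}

lemma integrable_rpow_mul_rpow (hf : IsIntervalDensity f a b) {s : ℝ} (hs : s ∈ Ioo (0 : ℝ) 1)
    (ε : ℝ) : Integrable fun x => f (x + ε) ^ s * f x ^ (1 - s) := by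
  refine ((((hf.integrable.comp_add_right ε).const_mul s).add
    (hf.integrable.const_mul (1 - s))).sub (hf.integrable_amgmGap hs ε)).congr
    (ae_of_all _ fun x => ?_)
  simp [amgmGap]

lemma integral_rpow_mul_rpow (hf : IsIntervalDensity f a b) {s : ℝ} (hs : s ∈ Ioo (0 : ℝ) 1)
    (ε : ℝ) : ∫ x, f (x + ε) ^ s * f x ^ (1 - s) = 1 - ∫ x, amgmGap s (f (x + ε)) (f x) := by
  have e : ∀ x, f (x + ε) ^ s * f x ^ (1 - s) =
      (s * f (x + ε) + (1 - s) * f x) - amgmGap s (f (x + ε)) (f x) := fun x => by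
    simp [amgmGap]
  have h1 := (hf.integrable.comp_add_right ε).const_mul s
  have h2 := hf.integrable.const_mul (1 - s)
  have h3 : Integrable fun x => s * f (x + ε) + (1 - s) * f x := h1.add h2
  simp_rw [e]
  rw [integral_sub h3 (hf.integrable_amgmGap hs ε), integral_add h1 h2,
    integral_const_mul, integral_const_mul, integral_add_right_eq_self f ε, hf.integral_eq_one]
  ring

lemma lintegral_rpow_mul_rpow (hf : IsIntervalDensity f a b) {s : ℝ} (hs : s ∈ Ioo (0 : ℝ) 1)
    (θ₁ θ₂ : ℝ) :
    ∫⁻ x, ENNReal.ofReal (shiftFamily f θ₁ x ^ s * shiftFamily f θ₂ x ^ (1 - s)) =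
      ENNReal.ofReal (1 - ∫ x, amgmGap s (f (x + (θ₂ - θ₁))) (f x)) := by
  rw [← hf.integral_rpow_mul_rpow hs, ofReal_integral_eq_lintegral_ofReal
    (hf.integrable_rpow_mul_rpow hs _) (ae_of_all _ fun x => mul_nonneg
      (Real.rpow_nonneg (hf.nonneg _) _) (Real.rpow_nonneg (hf.nonneg _) _))]
  symm
  rw [← lintegral_sub_right_eq_self _ θ₂]
  simp only [shiftFamily, sub_add_sub_cancel]

lemma renyiEntropy_shift (hf : IsIntervalDensity f a b) {s : ℝ} (hs : s ∈ Ioo (0 : ℝ) 1)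
    {θ₁ θ₂ : ℝ} (h : ∫ x, amgmGap s (f (x + (θ₂ - θ₁))) (f x) < 1) :
    renyiEntropy s (shiftFamily f θ₁) (shiftFamily f θ₂) = shiftEntropy f s (θ₂ - θ₁) := by
  rw [renyiEntropy, hf.lintegral_rpow_mul_rpow hs, ENNReal.log_ofReal_of_pos (sub_pos.2 h),
    shiftEntropy, EReal.coe_neg]

variable {κ A : ℝ}

lemma tendsto_deficit (hf : IsIntervalDensity f a b) (hκ1 : 1 < κ) (hκ : κ < 2) (hA : 0 < A)
    (ht : 1 ≤ thresholdFun (2 - κ)) (hl : LeftEndpoint f a κ A)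
    (hr : NegligibleRightEndpoint f b κ) :
    Tendsto (fun i : ℝ × ℝ => ∫ x, amgmGap i.2 (f (x + i.1)) (f x))
      (𝓝[>] 0 ×ˢ 𝓟 (Ioo 0 1)) (𝓝 0) := by
  have hpow : Tendsto (fun i : ℝ × ℝ => i.1 ^ κ) (𝓝[>] 0 ×ˢ 𝓟 (Ioo 0 1)) (𝓝 0) :=
    (tendsto_rpow_nhdsGT_zero (by linarith)).comp tendsto_fst
  have hb : ∀ᶠ i : ℝ × ℝ in 𝓝[>] 0 ×ˢ 𝓟 (Ioo 0 1),
      (∫ x, amgmGap i.2 (f (x + i.1)) (f x)) ≤ (A + 1) * i.1 ^ κ := by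
    filter_upwards [eventually_prod_principal_Ioo,
      (hf.tendsto_integral_amgmGap hκ1 hκ hA hl hr).eventually (gt_mem_nhds one_pos)] with i hi h1
    have hε : 0 < i.1 ^ κ := Real.rpow_pos_of_pos hi.1 κ
    have h2 := powerRate_le (α := κ - 1) (by linarith) (by linarith)
      (by rwa [show 1 - (κ - 1) = 2 - κ by ring]) hi.2
    have h3 : 1 / (1 + (κ - 1)) ≤ 1 := by
      rw [div_le_one (by linarith)]; linarith
    have h4 : A * powerRate (κ - 1) i.2 ≤ A := by nlinarith
    rw [← div_le_iff₀ hε]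
    linarith
  refine squeeze_zero' ?_ hb (by simpa using hpow.const_mul (A + 1))
  filter_upwards [eventually_prod_principal_Ioo] with i hi
  exact integral_nonneg fun x => amgmGap_nonneg hi.2 (hf.nonneg _) (hf.nonneg _)

lemma tendsto_shiftEntropy (hf : IsIntervalDensity f a b) (hκ1 : 1 < κ) (hκ : κ < 2) (hA : 0 < A)
    (ht : 1 ≤ thresholdFun (2 - κ)) (hl : LeftEndpoint f a κ A)
    (hr : NegligibleRightEndpoint f b κ) :
    Tendsto (fun i : ℝ × ℝ => shiftEntropy f i.2 i.1 / i.1 ^ κ - A * powerRate (κ - 1) i.2)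
      (𝓝[>] 0 ×ˢ 𝓟 (Ioo 0 1)) (𝓝 0) := by
  have h0 := hf.tendsto_deficit hκ1 hκ hA ht hl hr
  have h1 := hf.tendsto_integral_amgmGap hκ1 hκ hA hl hr
  set Δ : ℝ × ℝ → ℝ := fun i => ∫ x, amgmGap i.2 (f (x + i.1)) (f x)
  have h2 : Tendsto (fun i => |Δ i / i.1 ^ κ - A * powerRate (κ - 1) i.2| + 2 * (A + 1) * Δ i)
      (𝓝[>] 0 ×ˢ 𝓟 (Ioo 0 1)) (𝓝 0) := by
    simpa using h1.abs.add (h0.const_mul (2 * (A + 1)))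
  refine squeeze_zero_norm' ?_ h2
  filter_upwards [eventually_prod_principal_Ioo, h0.eventually (gt_mem_nhds one_half_pos),
    h1.eventually (gt_mem_nhds one_pos)] with i hi hd h1i
  have hε : 0 < i.1 ^ κ := Real.rpow_pos_of_pos hi.1 κ
  have hΔ : 0 ≤ Δ i :=
    integral_nonneg fun x => amgmGap_nonneg hi.2 (hf.nonneg _) (hf.nonneg _)
  have hd : Δ i < 1 / 2 := hd
  have h1i : Δ i / i.1 ^ κ - A * powerRate (κ - 1) i.2 < 1 := h1i
  have hp : powerRate (κ - 1) i.2 ≤ 1 := by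
    refine (powerRate_le (α := κ - 1) (by linarith) (by linarith)
      (by rwa [show 1 - (κ - 1) = 2 - κ by ring]) hi.2).trans ?_
    rw [div_le_one (by linarith)]; linarith
  have hΔε : Δ i / i.1 ^ κ ≤ A + 1 := by nlinarith
  have hS : shiftEntropy f i.2 i.1 = -Real.log (1 - Δ i) := rfl
  have hlow : Δ i ≤ shiftEntropy f i.2 i.1 := by
    rw [hS]
    linarith [Real.log_le_sub_one_of_pos (show 0 < 1 - Δ i by linarith)]
  -- For 0 ≤ Δ ≤ 1/2 the logarithm exceeds the deficit by at most 2Δ²; since Δ/ε^κ stays bounded by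
  -- A + 1, this is negligible after division by ε^κ.
  have hup : shiftEntropy f i.2 i.1 - Δ i ≤ 2 * Δ i ^ 2 := by
    rw [hS]
    have h := Real.one_sub_inv_le_log_of_pos (show 0 < 1 - Δ i by linarith)
    have h3 : (1 - Δ i)⁻¹ ≤ 1 + Δ i + 2 * Δ i ^ 2 := by
      rw [inv_le_iff_one_le_mul₀ (by linarith)]
      nlinarith [mul_nonneg (sq_nonneg (Δ i)) (show 0 ≤ 1 / 2 - Δ i by linarith)]
    linarith
  rw [Real.norm_eq_abs]
  have e : shiftEntropy f i.2 i.1 / i.1 ^ κ - A * powerRate (κ - 1) i.2 =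
      (Δ i / i.1 ^ κ - A * powerRate (κ - 1) i.2) +
        (shiftEntropy f i.2 i.1 - Δ i) / i.1 ^ κ := by ring
  rw [e]
  refine (abs_add_le _ _).trans (add_le_add le_rfl ?_)
  rw [abs_of_nonneg (div_nonneg (sub_nonneg.2 hlow) hε.le)]
  calc _ ≤ 2 * Δ i ^ 2 / i.1 ^ κ := by gcongr
    _ = 2 * (Δ i / i.1 ^ κ) * Δ i := by ring
    _ ≤ 2 * (A + 1) * Δ i := by gcongr

lemma eventually_renyiRatio_eq (hf : IsIntervalDensity f a b) (hκ1 : 1 < κ) (hκ : κ < 2)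
    (hA : 0 < A) (ht : 1 ≤ thresholdFun (2 - κ)) (hl : LeftEndpoint f a κ A)
    (hr : NegligibleRightEndpoint f b κ) (θ : ℝ) :
    ∀ᶠ i : ℝ × ℝ in 𝓝[>] 0 ×ˢ 𝓟 (Ioo 0 1),
      renyiRatio (shiftFamily f) (fun x => |x| ^ κ) θ i.2 i.1 =
        ((shiftEntropy f i.2 i.1 / i.1 ^ κ : ℝ) : EReal) := by
  filter_upwards [eventually_prod_principal_Ioo,
    (hf.tendsto_deficit hκ1 hκ hA ht hl hr).eventually (gt_mem_nhds one_pos)] with i hi hd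
  have e : θ + i.1 / 2 - (θ - i.1 / 2) = i.1 := by ring
  rw [renyiRatio, hf.renyiEntropy_shift hi.2 (by rwa [e]), e, abs_of_pos hi.1, EReal.coe_div]

lemma uniformRenyi (hf : IsIntervalDensity f a b) (hκ1 : 1 < κ) (hκ : κ < 2)
    (hA : 0 < A) (ht : 1 ≤ thresholdFun (2 - κ)) (hl : LeftEndpoint f a κ A)
    (hr : NegligibleRightEndpoint f b κ) (θ : ℝ) {η : ℝ} (hη : 0 < η) :
    ∀ᶠ ε in 𝓝[>] (0 : ℝ), ∀ s ∈ Ioo (0 : ℝ) 1,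
      ((A * powerRate (κ - 1) s - η : ℝ) : EReal) ≤
          renyiRatio (shiftFamily f) (fun x => |x| ^ κ) θ s ε ∧
        renyiRatio (shiftFamily f) (fun x => |x| ^ κ) θ s ε ≤
          ((A * powerRate (κ - 1) s + η : ℝ) : EReal) := by
  have h : ∀ᶠ i : ℝ × ℝ in 𝓝[>] 0 ×ˢ 𝓟 (Ioo 0 1),
      ((A * powerRate (κ - 1) i.2 - η : ℝ) : EReal) ≤
          renyiRatio (shiftFamily f) (fun x => |x| ^ κ) θ i.2 i.1 ∧
        renyiRatio (shiftFamily f) (fun x => |x| ^ κ) θ i.2 i.1 ≤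
          ((A * powerRate (κ - 1) i.2 + η : ℝ) : EReal) := by
    have h0 := hf.tendsto_shiftEntropy hκ1 hκ hA ht hl hr
    filter_upwards [hf.eventually_renyiRatio_eq hκ1 hκ hA ht hl hr θ,
      h0.eventually (lt_mem_nhds (neg_lt_zero.2 hη)), h0.eventually (gt_mem_nhds hη)]
      with i h1 h2 h3
    rw [h1]
    exact ⟨EReal.coe_le_coe_iff.2 (by linarith), EReal.coe_le_coe_iff.2 (by linarith)⟩
  exact eventually_prod_principal_iff.1 h

lemma tendsto_shiftEntropy_div (hf : IsIntervalDensity f a b) (hκ1 : 1 < κ) (hκ : κ < 2)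
    (hA : 0 < A) (ht : 1 ≤ thresholdFun (2 - κ)) (hl : LeftEndpoint f a κ A)
    (hr : NegligibleRightEndpoint f b κ) {s : ℝ} (hs : s ∈ Ioo (0 : ℝ) 1) :
    Tendsto (fun ε => shiftEntropy f s ε / ε ^ κ) (𝓝[>] 0) (𝓝 (A * powerRate (κ - 1) s)) := by
  have hm : Tendsto (fun ε : ℝ => (ε, s)) (𝓝[>] 0) (𝓝[>] 0 ×ˢ 𝓟 (Ioo 0 1)) :=
    tendsto_id.prodMk (tendsto_principal.2 (Eventually.of_forall fun _ => hs))
  have := ((hf.tendsto_shiftEntropy hκ1 hκ hA ht hl hr).comp hm).add_const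
    (A * powerRate (κ - 1) s)
  simpa [Function.comp_def] using this

lemma renyiRate_eq (hf : IsIntervalDensity f a b) (hκ1 : 1 < κ) (hκ : κ < 2)
    (hA : 0 < A) (ht : 1 ≤ thresholdFun (2 - κ)) (hl : LeftEndpoint f a κ A)
    (hr : NegligibleRightEndpoint f b κ) (θ : ℝ) {s : ℝ} (hs : s ∈ Ioo (0 : ℝ) 1) :
    renyiRate (shiftFamily f) (fun x => |x| ^ κ) θ s = ((A * powerRate (κ - 1) s : ℝ) : EReal) := by
  refine Tendsto.limUnder_eq ?_
  have h1 := (continuous_coe_real_ereal.tendsto _).comp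
    (hf.tendsto_shiftEntropy_div hκ1 hκ hA ht hl hr hs)
  refine h1.congr' ?_
  have h2 := eventually_prod_principal_iff.1
    (hf.eventually_renyiRatio_eq hκ1 hκ hA ht hl hr θ)
  filter_upwards [h2] with ε hε
  exact (hε s hs).symm

lemma alphaOneBar_eq (hf : IsIntervalDensity f a b) (hκ1 : 1 < κ) (hκ : κ < 2)
    (hA : 0 < A) (ht : 1 ≤ thresholdFun (2 - κ)) (hl : LeftEndpoint f a κ A)
    (hr : NegligibleRightEndpoint f b κ) (θ : ℝ) :
    alphaOneBar (shiftFamily f) (fun x => |x| ^ κ) κ θ = ((A * 2 ^ κ / κ : ℝ) : EReal) := by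
  have ht' : 1 ≤ thresholdFun (1 - (κ - 1)) := by rwa [show 1 - (κ - 1) = 2 - κ by ring]
  have e1 : 1 + (κ - 1) = κ := by ring
  have hsup : ⨆ s ∈ Ioo (0 : ℝ) 1, renyiRate (shiftFamily f) (fun x => |x| ^ κ) θ s =
      ((A / κ : ℝ) : EReal) := by
    refine le_antisymm (iSup₂_le fun s hs => ?_) ?_
    · rw [hf.renyiRate_eq hκ1 hκ hA ht hl hr θ hs, EReal.coe_le_coe_iff]
      have := powerRate_le (by linarith) (by linarith) ht' hs
      rw [e1] at this
      calc _ ≤ A * (1 / κ) := by gcongr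
        _ = _ := by ring
    · refine EReal.ge_of_forall_gt_iff_ge.1 fun z hz => ?_
      rw [EReal.coe_lt_coe_iff] at hz
      -- The supremum is approached as s → 1, through the contribution s/κ of the uncovered
      -- interval.
      obtain ⟨s, hs1, hs2⟩ : ∃ s ∈ Ioo (0 : ℝ) 1, z ≤ A * (s * (1 / κ)) := by
        have hlim : Tendsto (fun s : ℝ => A * (s * (1 / κ))) (𝓝[<] 1) (𝓝 (A / κ)) := by
          have : ContinuousAt (fun s : ℝ => A * (s * (1 / κ))) 1 := by fun_prop
          have h := this.tendsto.mono_left (nhdsWithin_le_nhds (s := Iio 1))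
          simpa [div_eq_mul_inv] using h
        have h01 : ∀ᶠ s in 𝓝[<] (1 : ℝ), s ∈ Ioo (0 : ℝ) 1 := Ioo_mem_nhdsLT one_pos
        obtain ⟨s, h1, h2⟩ := (h01.and (hlim.eventually (lt_mem_nhds hz))).exists
        exact ⟨s, h1, h2.le⟩
      refine le_trans ?_ (le_iSup₂ (f := fun s (_ : s ∈ Ioo (0 : ℝ) 1) =>
        renyiRate (shiftFamily f) (fun x => |x| ^ κ) θ s) s hs1)
      rw [hf.renyiRate_eq hκ1 hκ hA ht hl hr θ hs1, EReal.coe_le_coe_iff]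
      have := le_powerRate (α := κ - 1) (by linarith) (by linarith) hs1
      rw [e1] at this
      exact hs2.trans (by gcongr)
  rw [alphaOneBar, hsup, ← EReal.coe_mul]
  congr 1
  ring

end IsIntervalDensity

/-! ### Product laws, Hölder's inequality and the two-point converse -/

lemma densityMeasure_univ (p : ℝ → ℝ) :
    densityMeasure p univ = ∫⁻ x, ENNReal.ofReal (p x) := by
  rw [densityMeasure, withDensity_apply _ MeasurableSet.univ, Measure.restrict_univ]

lemma isFiniteMeasure_densityMeasure {p : ℝ → ℝ} (hp : Integrable p) :
    IsFiniteMeasure (densityMeasure p) :=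
  isFiniteMeasure_withDensity_ofReal hp.2

lemma iidLaw_eq_withDensity {p : ℝ → ℝ} (hp : Integrable p)
    (h0 : ∀ x, 0 ≤ p x) (n : ℕ) :
    iidLaw p n = (volume : Measure (Fin n → ℝ)).withDensity
      fun x => ENNReal.ofReal (∏ i, p (x i)) := by
  have := isFiniteMeasure_densityMeasure hp
  refine Measure.pi_eq fun s hs => ?_
  have hI : ∀ i, Integrable ((s i).indicator p) := fun i => hp.indicator (hs i)
  have hn : ∀ i x, 0 ≤ (s i).indicator p x := fun i x => indicator_nonneg (fun _ _ => h0 _) x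
  have hprod : ∀ x : Fin n → ℝ, (pi univ s).indicator (fun x => ENNReal.ofReal (∏ i, p (x i))) x =
      ENNReal.ofReal (∏ i, (s i).indicator p (x i)) := by
    intro x
    by_cases hx : x ∈ pi univ s
    · rw [indicator_of_mem hx]
      congr 1
      exact Finset.prod_congr rfl fun i _ => (indicator_of_mem (hx i (mem_univ i)) p).symm
    · rw [indicator_of_notMem hx]
      rw [mem_univ_pi, not_forall] at hx
      obtain ⟨i, hi⟩ := hx
      rw [Finset.prod_eq_zero (Finset.mem_univ i) (indicator_of_notMem hi p), ENNReal.ofReal_zero]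
  have hInt : Integrable fun x : Fin n → ℝ => ∏ i, (s i).indicator p (x i) :=
    Integrable.fintype_prod (f := fun i => (s i).indicator p) hI
  rw [withDensity_apply _ (MeasurableSet.univ_pi hs),
    ← lintegral_indicator (MeasurableSet.univ_pi hs)]
  simp_rw [hprod]
  rw [← ofReal_integral_eq_lintegral_ofReal hInt
    (ae_of_all _ fun x => Finset.prod_nonneg fun i _ => hn i _),
    integral_fintype_prod_volume_eq_prod (fun i => (s i).indicator p),
    ENNReal.ofReal_prod_of_nonneg fun i _ => integral_nonneg (hn i)]
  refine Finset.prod_congr rfl fun i _ => ?_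
  rw [densityMeasure, withDensity_apply _ (hs i), integral_indicator (hs i),
    ofReal_integral_eq_lintegral_ofReal hp.integrableOn (ae_of_all _ h0)]

lemma iidLaw_univ {p : ℝ → ℝ} (hp : Integrable p) (n : ℕ) :
    iidLaw p n univ = (∫⁻ x, ENNReal.ofReal (p x)) ^ n := by
  have := isFiniteMeasure_densityMeasure hp
  rw [iidLaw, Measure.pi_univ, Finset.prod_const, Finset.card_univ, Fintype.card_fin,
    densityMeasure_univ]

/-- Hölder's inequality for the product laws of unnormalized densities. -/
lemma iidLaw_le_rpow_mul_rpow {u v w : ℝ → ℝ} {l : ℝ} (hl0 : 0 ≤ l) (hl1 : l ≤ 1)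
    (hvm : Measurable v) (hwm : Measurable w)
    (hu : Integrable u) (hv : Integrable v) (hw : Integrable w)
    (hu0 : ∀ x, 0 ≤ u x) (hv0 : ∀ x, 0 ≤ v x) (hw0 : ∀ x, 0 ≤ w x)
    (h : ∀ x, u x = v x ^ (1 - l) * w x ^ l) (n : ℕ) {E : Set (Fin n → ℝ)}
    (hE : MeasurableSet E) :
    iidLaw u n E ≤ iidLaw v n E ^ (1 - l) * iidLaw w n univ ^ l := by
  have hmeas : ∀ {p : ℝ → ℝ}, Measurable p →
      Measurable fun x : Fin n → ℝ => ENNReal.ofReal (∏ i, p (x i)) := fun hp =>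
    (Finset.measurable_prod _ fun i _ => hp.comp (measurable_pi_apply i)).ennreal_ofReal
  calc iidLaw u n E ≤ iidLaw v n E ^ (1 - l) * iidLaw w n E ^ l := by
        rw [iidLaw_eq_withDensity hu hu0, iidLaw_eq_withDensity hv hv0,
          iidLaw_eq_withDensity hw hw0, withDensity_apply _ hE, withDensity_apply _ hE,
          withDensity_apply _ hE]
        refine le_trans (le_of_eq ?_) (ENNReal.lintegral_mul_norm_pow_le
          (hmeas hvm).aemeasurable (hmeas hwm).aemeasurable (sub_nonneg.2 hl1) hl0 (by ring))
        refine lintegral_congr fun x => ?_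
        have e1 : 0 ≤ ∏ i, v (x i) := Finset.prod_nonneg fun i _ => hv0 _
        have e2 : 0 ≤ ∏ i, w (x i) := Finset.prod_nonneg fun i _ => hw0 _
        rw [ENNReal.ofReal_rpow_of_nonneg e1 (sub_nonneg.2 hl1),
          ENNReal.ofReal_rpow_of_nonneg e2 hl0, ← ENNReal.ofReal_mul (by positivity),
          ← Real.finsetProd_rpow _ _ (fun i _ => hv0 _),
          ← Real.finsetProd_rpow _ _ (fun i _ => hw0 _), ← Finset.prod_mul_distrib]
        simp_rw [← h]
    _ ≤ _ := by gcongr; exact subset_univ E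

/-- The condition on l says that s is the mean of 1 and t with weights 1 - l and l: the tilted
density of order s interpolates between x and the tilted density of order t. -/
lemma rpow_mul_rpow_interpolate {x y s t l : ℝ} (hx : 0 ≤ x) (hy : 0 ≤ y) (hs : s ∈ Ioo (0 : ℝ) 1)
    (h : l * (1 - t) = 1 - s) :
    x ^ s * y ^ (1 - s) = x ^ (1 - l) * (x ^ t * y ^ (1 - t)) ^ l := by
  have h1 : (1 - l) + t * l = s := by linarith
  rw [Real.mul_rpow (by positivity) (by positivity), ← Real.rpow_mul hx, ← Real.rpow_mul hy,
    ← mul_assoc, ← Real.rpow_add' hx (by rw [h1]; exact hs.1.ne'), h1, mul_comm (1 - t), h]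

lemma measurable_rpow_mul_rpow {p q : ℝ → ℝ} (hp : Measurable p) (hq : Measurable q) (s : ℝ) :
    Measurable fun x => p x ^ s * q x ^ (1 - s) := by fun_prop

/-- The exponent bound behind the converse: no test can have both error exponents above `R`. -/
lemma not_both_errors_small {z y₁ y₂ : ℝ} {l m R : ℝ} (hz : 0 < z) (hy₁ : 0 < y₁) (hy₂ : 0 < y₂)
    (h1 : Real.exp (-R * (1 - l)) * y₁ ^ l < z) (h2 : Real.exp (-R * (1 - m)) * y₂ ^ m < z)
    (h : ∀ᶠ n : ℕ in atTop, z ^ n ≤ Real.exp (-R * n) ^ (1 - l) * (y₁ ^ n) ^ l +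
      Real.exp (-R * n) ^ (1 - m) * (y₂ ^ n) ^ m) : False := by
  have e : ∀ (y k : ℝ) (n : ℕ), 0 < y →
      Real.exp (-R * n) ^ (1 - k) * (y ^ n) ^ k = (Real.exp (-R * (1 - k)) * y ^ k) ^ n := by
    intro y k n hy
    rw [mul_pow, ← Real.exp_mul, ← Real.exp_nat_mul, ← Real.rpow_natCast y n, ← Real.rpow_mul hy.le,
      ← Real.rpow_natCast (y ^ k) n, ← Real.rpow_mul hy.le]
    congr 2 <;> ring
  have hlim : ∀ {c : ℝ}, 0 ≤ c → c < z → Tendsto (fun n : ℕ => (c / z) ^ n) atTop (𝓝 0) :=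
    fun hc hcz => tendsto_pow_atTop_nhds_zero_of_lt_one (by positivity) ((div_lt_one hz).2 hcz)
  -- Both terms on the right are n-th powers of bases below z, so divided by z^n they tend to 0,
  -- although their sum must stay at least 1.
  have hl := (hlim (by positivity) h1).add (hlim (by positivity) h2)
  rw [add_zero] at hl
  obtain ⟨n, hn1, hn2⟩ := (h.and (hl.eventually (gt_mem_nhds one_pos))).exists
  rw [e _ _ _ hy₁, e _ _ _ hy₂] at hn1
  rw [div_pow, div_pow, ← add_div, div_lt_one (by positivity)] at hn2
  linarith

lemma eventually_le_of_lt_expRate {p : ℝ → ℝ → ℝ} {T : Estimator} {θ ε R : ℝ}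
    (h : (R : EReal) < expRate p T θ ε) :
    ∀ᶠ n : ℕ in atTop, iidLaw (p θ) n {x | ε ≤ |T.toFun n x - θ|} ≤
      ENNReal.ofReal (Real.exp (-R * n)) := by
  filter_upwards [eventually_lt_of_lt_liminf h, eventually_gt_atTop 0] with n hn hn0
  have hn' : (0 : EReal) < n := by exact_mod_cast hn0
  rw [EReal.lt_div_iff hn' (EReal.natCast_ne_top n), EReal.lt_neg_comm] at hn
  have e : -((R : EReal) * n) = ENNReal.log (ENNReal.ofReal (Real.exp (-R * n))) := by
    rw [ENNReal.log_ofReal_of_pos (Real.exp_pos _), Real.log_exp]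
    push_cast
    rw [EReal.neg_mul]
  rw [e, ENNReal.log_lt_log_iff] at hn
  exact hn.le

namespace IsIntervalDensity

variable {f : ℝ → ℝ} {a : ℝ} {b : EReal} {κ A : ℝ}

/-- The converse part of Chernoff's theorem, for the two-point problem `θ ± ε`. -/
lemma worstRate_le (hf : IsIntervalDensity f a b) {θ ε R s s₁ s₂ : ℝ} (hε : 0 < ε)
    (hs : s ∈ Ioo (0 : ℝ) 1) (hs₁ : s₁ ∈ Ioo (0 : ℝ) 1) (hs₂ : s₂ ∈ Ioo (0 : ℝ) 1)
    (h1s : s₁ < s) (hs2 : s < s₂)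
    (hd : ∫ x, amgmGap s (f (x + 2 * ε)) (f x) < 1)
    (hd₁ : ∫ x, amgmGap s₁ (f (x + 2 * ε)) (f x) < 1)
    (hd₂ : ∫ x, amgmGap s₂ (f (x + 2 * ε)) (f x) < 1)
    (h1 : shiftEntropy f s (2 * ε) < R * (1 - (1 - s) / (1 - s₁)) +
      (1 - s) / (1 - s₁) * shiftEntropy f s₁ (2 * ε))
    (h2 : shiftEntropy f s (2 * ε) < R * (1 - s / s₂) + s / s₂ * shiftEntropy f s₂ (2 * ε))
    (T : Estimator) : worstRate (shiftFamily f) T θ ε ≤ R := by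
  by_contra hcon
  rw [not_le] at hcon
  have hp := eventually_le_of_lt_expRate (hcon.trans_le (iInf₂_le (θ - ε)
    (by constructor <;> linarith)))
  have hq := eventually_le_of_lt_expRate (hcon.trans_le (iInf₂_le (θ + ε)
    (by constructor <;> linarith)))
  set p := shiftFamily f (θ - ε) with hpdef
  set q := shiftFamily f (θ + ε) with hqdef
  have hgap : θ + ε - (θ - ε) = 2 * ε := by ring
  have hpm : Measurable p := hf.measurable.comp (measurable_sub_const _)
  have hqm : Measurable q := hf.measurable.comp (measurable_sub_const _)
  have hpI : Integrable p := hf.integrable.comp_sub_right _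
  have hqI : Integrable q := hf.integrable.comp_sub_right _
  have hp0 : ∀ x, 0 ≤ p x := fun x => hf.nonneg _
  have hq0 : ∀ x, 0 ≤ q x := fun x => hf.nonneg _
  set W : ℝ → ℝ → ℝ := fun r x => p x ^ r * q x ^ (1 - r) with hW
  have hWm : ∀ r, Measurable (W r) := measurable_rpow_mul_rpow hpm hqm
  have hW0 : ∀ r x, 0 ≤ W r x := fun r x =>
    mul_nonneg (Real.rpow_nonneg (hp0 x) _) (Real.rpow_nonneg (hq0 x) _)
  have hWI : ∀ r ∈ Ioo (0 : ℝ) 1, Integrable (W r) := fun r hr => by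
    have := (hf.integrable_rpow_mul_rpow hr (2 * ε)).comp_sub_right (θ + ε)
    refine this.congr (ae_of_all _ fun x => ?_)
    simp only [hW, hpdef, hqdef, shiftFamily]
    rw [show x - (θ + ε) + 2 * ε = x - (θ - ε) by ring]
  set Z : ℝ → ℝ := fun r => 1 - ∫ x, amgmGap r (f (x + 2 * ε)) (f x) with hZ
  have hWZ : ∀ r ∈ Ioo (0 : ℝ) 1, ∀ n, 0 < Z r →
      iidLaw (W r) n univ = ENNReal.ofReal (Z r ^ n) := fun r hr n hZr => by
    rw [iidLaw_univ (hWI r hr), hf.lintegral_rpow_mul_rpow hr, hgap,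
      ENNReal.ofReal_pow hZr.le]
  have hz : 0 < Z s := sub_pos.2 hd
  have hz₁ : 0 < Z s₁ := sub_pos.2 hd₁
  have hz₂ : 0 < Z s₂ := sub_pos.2 hd₂
  have h1s' : 0 < 1 - s₁ := sub_pos.2 hs₁.2
  have hs' : 0 < 1 - s := sub_pos.2 hs.2
  set l := (1 - s) / (1 - s₁) with hl
  set m := s / s₂ with hm
  have hl0 : 0 < l := div_pos hs' h1s'
  have hl1 : l ≤ 1 := (div_le_one h1s').2 (by linarith)
  have hm0 : 0 < m := div_pos hs.1 hs₂.1
  have hm1 : m ≤ 1 := (div_le_one hs₂.1).2 hs2.le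
  have hexp : ∀ {y k : ℝ}, 0 < y → -Real.log (Z s) < R * (1 - k) + k * -Real.log y →
      Real.exp (-R * (1 - k)) * y ^ k < Z s := by
    intro y k hy h
    rw [Real.rpow_def_of_pos hy, ← Real.exp_add, ← Real.lt_log_iff_exp_lt hz]
    linarith
  refine not_both_errors_small hz hz₁ hz₂ (hexp hz₁ h1) (hexp hz₂ h2) ?_
  filter_upwards [hp, hq] with n hpn hqn
  -- The induced test decides for θ + ε when T ≥ θ; a wrong decision forces an estimation error of
  -- at least ε at the true parameter.
  set E : Set (Fin n → ℝ) := {x | θ ≤ T.toFun n x} with hE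
  have hEm : MeasurableSet E := measurableSet_le measurable_const (T.measurable_toFun n)
  have hE1 : iidLaw p n E ≤ ENNReal.ofReal (Real.exp (-R * n)) := by
    refine (measure_mono fun x hx => ?_).trans hpn
    have hx : θ ≤ T.toFun n x := hx
    have h : ε ≤ T.toFun n x - (θ - ε) := by linarith
    exact h.trans (le_abs_self _)
  have hE2 : iidLaw q n Eᶜ ≤ ENNReal.ofReal (Real.exp (-R * n)) := by
    refine (measure_mono fun x hx => ?_).trans hqn
    have hx : T.toFun n x < θ := not_le.1 hx
    have h : ε ≤ -(T.toFun n x - (θ + ε)) := by linarith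
    exact h.trans (neg_le_abs _)
  have hb1 := iidLaw_le_rpow_mul_rpow hl0.le hl1 hpm (hWm s₁) (hWI s hs) hpI
    (hWI s₁ hs₁) (hW0 s) hp0 (hW0 s₁)
    (fun x => rpow_mul_rpow_interpolate (hp0 x) (hq0 x) hs
      (div_mul_cancel₀ _ h1s'.ne')) n hEm
  have hb2 := iidLaw_le_rpow_mul_rpow hm0.le hm1 hqm (hWm s₂) (hWI s hs) hqI
    (hWI s₂ hs₂) (hW0 s) hq0 (hW0 s₂)
    (fun x => by
      have h := rpow_mul_rpow_interpolate (s := 1 - s) (t := 1 - s₂) (l := m) (hq0 x) (hp0 x)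
        ⟨hs', by linarith [hs.1]⟩
        (by rw [sub_sub_cancel, sub_sub_cancel]; exact div_mul_cancel₀ _ hs₂.1.ne')
      simp only [sub_sub_cancel] at h
      simp only [hW]
      rw [mul_comm, h, mul_comm (q x ^ (1 - s₂))]) n hEm.compl
  rw [hWZ s₁ hs₁ n hz₁] at hb1
  rw [hWZ s₂ hs₂ n hz₂] at hb2
  have hsum : ENNReal.ofReal (Z s ^ n) ≤
      ENNReal.ofReal (Real.exp (-R * n)) ^ (1 - l) * ENNReal.ofReal (Z s₁ ^ n) ^ l +
      ENNReal.ofReal (Real.exp (-R * n)) ^ (1 - m) * ENNReal.ofReal (Z s₂ ^ n) ^ m := by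
    -- The tilted mass Z s ^ n splits over E and its complement. Order s₁ is interpolated with p on
    -- E, order s₂ with q on the complement.
    rw [← hWZ s hs n hz, ← measure_add_measure_compl hEm]
    have hl' := sub_nonneg.2 hl1
    have hm' := sub_nonneg.2 hm1
    exact add_le_add (hb1.trans (by gcongr)) (hb2.trans (by gcongr))
  rw [ENNReal.ofReal_rpow_of_nonneg (Real.exp_pos _).le (sub_nonneg.2 hl1),
    ENNReal.ofReal_rpow_of_nonneg (Real.exp_pos _).le (sub_nonneg.2 hm1),
    ENNReal.ofReal_rpow_of_nonneg (by positivity) hl0.le,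
    ENNReal.ofReal_rpow_of_nonneg (by positivity) hm0.le,
    ← ENNReal.ofReal_mul (by positivity), ← ENNReal.ofReal_mul (by positivity),
    ← ENNReal.ofReal_add (by positivity) (by positivity)] at hsum
  exact (ENNReal.ofReal_le_ofReal_iff (by positivity)).1 hsum

end IsIntervalDensity

/-! ### The shifted minimum estimator -/

namespace IsIntervalDensity

variable {f : ℝ → ℝ} {a : ℝ} {b : EReal} {κ A : ℝ}

lemma densityMeasure_shift_apply (hf : IsIntervalDensity f a b) (θ : ℝ) {s : Set ℝ}
    (hs : MeasurableSet s) :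
    densityMeasure (shiftFamily f θ) s = ENNReal.ofReal (∫ x, s.indicator 1 (x + θ) * f x) := by
  have hI : Integrable (shiftFamily f θ) := hf.integrable.comp_sub_right θ
  rw [densityMeasure, withDensity_apply _ hs, ← ofReal_integral_eq_lintegral_ofReal hI.integrableOn
    (ae_of_all _ fun x => hf.nonneg _), ← integral_indicator hs,
    ← integral_add_right_eq_self _ θ]
  congr 2
  ext x
  by_cases hx : x + θ ∈ s <;> simp [hx, shiftFamily]

lemma setIntegral_Iio_add_Ici (hf : IsIntervalDensity f a b) (c : ℝ) :
    (∫ x in Iio c, f x) + ∫ x in Ici c, f x = 1 := by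
  rw [← compl_Iio, integral_add_compl measurableSet_Iio hf.integrable, hf.integral_eq_one]

lemma densityMeasure_shift_Ici (hf : IsIntervalDensity f a b) (θ c : ℝ) :
    densityMeasure (shiftFamily f θ) (Ici (θ + c)) =
      ENNReal.ofReal (1 - ∫ x in Iio c, f x) := by
  rw [hf.densityMeasure_shift_apply θ measurableSet_Ici,
    show 1 - ∫ x in Iio c, f x = ∫ x in Ici c, f x by linarith [hf.setIntegral_Iio_add_Ici c],
    ← integral_indicator measurableSet_Ici]
  congr 2
  ext x
  have : x + θ ∈ Ici (θ + c) ↔ x ∈ Ici c := by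
    simp only [mem_Ici]; constructor <;> intro h <;> linarith
  by_cases hx : x ∈ Ici c
  · simp only [indicator_of_mem hx, indicator_of_mem (this.2 hx), Pi.one_apply, one_mul]
  · simp only [indicator_of_notMem hx, indicator_of_notMem (fun h => hx (this.1 h)), zero_mul]

lemma densityMeasure_shift_Ioi (hf : IsIntervalDensity f a b) (θ : ℝ) :
    densityMeasure (shiftFamily f θ) (Ioi (θ + a)) = 1 := by
  rw [hf.densityMeasure_shift_apply θ measurableSet_Ioi, ← ENNReal.ofReal_one]
  congr 1
  rw [← hf.integral_eq_one]
  congr 1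
  ext x
  by_cases hx : a < x
  · rw [indicator_of_mem (by simp only [mem_Ioi]; linarith), Pi.one_apply, one_mul]
  · rw [hf.eq_zero x fun h => hx h.1, mul_zero]

/-- Almost surely every observation exceeds θ + a, so the estimate exceeds θ - ε and can only err
upwards, when all observations are at least θ + a + 2ε. For n = 0 the infimum is a default value,
hence the restriction on n. -/
lemma iidLaw_shiftedMin (hf : IsIntervalDensity f a b) (θ ε : ℝ) {n : ℕ}
    (hn : n ≠ 0) :
    iidLaw (shiftFamily f θ) n {x | ε ≤ |(shiftedMin a ε).toFun n x - θ|} =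
      ENNReal.ofReal (1 - ∫ x in Iio (a + 2 * ε), f x) ^ n := by
  have : Nonempty (Fin n) := ⟨⟨0, Nat.pos_of_ne_zero hn⟩⟩
  have := isFiniteMeasure_densityMeasure (hf.integrable.comp_sub_right θ)
  have hbox : ∀ s : Set ℝ, iidLaw (shiftFamily f θ) n (pi univ fun _ => s) =
      densityMeasure (shiftFamily f θ) s ^ n := fun s => by
    have : IsFiniteMeasure (densityMeasure (shiftFamily f θ)) := this
    rw [iidLaw, Measure.pi_pi, Finset.prod_const, Finset.card_univ, Fintype.card_fin]
  rw [← hf.densityMeasure_shift_Ici θ, ← hbox]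
  have hnull : iidLaw (shiftFamily f θ) n (pi univ fun _ => Ioi (θ + a))ᶜ = 0 := by
    have h1 : iidLaw (shiftFamily f θ) n (pi univ fun _ => Ioi (θ + a)) = 1 := by
      rw [hbox, hf.densityMeasure_shift_Ioi, one_pow]
    have h2 : iidLaw (shiftFamily f θ) n univ = 1 := by
      have hI : Integrable (shiftFamily f θ) := hf.integrable.comp_sub_right θ
      rw [iidLaw_univ hI]
      have h := lintegral_sub_right_eq_self (fun x => ENNReal.ofReal (f x)) θ (μ := volume)
      rw [hf.lintegral_eq_one] at h
      rw [show ∫⁻ x, ENNReal.ofReal (shiftFamily f θ x) = 1 from h, one_pow]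
    rw [measure_compl (MeasurableSet.univ_pi fun _ => measurableSet_Ioi) (by rw [h1]; simp),
      h1, h2, tsub_self]
  refine le_antisymm ?_ (measure_mono fun x hx => ?_)
  · have hsub : {x | ε ≤ |(shiftedMin a ε).toFun n x - θ|} ⊆
        (pi univ fun _ => Ici (θ + (a + 2 * ε))) ∪ (pi univ fun _ : Fin n => Ioi (θ + a))ᶜ := by
      intro x hx
      by_cases hx2 : x ∈ pi univ fun _ : Fin n => Ioi (θ + a)
      · left
        have hx : ε ≤ |(⨅ i, x i) - a - ε - θ| := hx
        obtain ⟨j, hj⟩ := exists_eq_ciInf_of_finite (f := x)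
        have hxj : θ + a < x j := hx2 j (mem_univ j)
        rw [hj] at hxj
        intro i _
        have hi : ⨅ i, x i ≤ x i := ciInf_le (finite_range x).bddBelow i
        rcases le_abs.1 hx with h | h
        · simp only [mem_Ici]; linarith
        · linarith
      · exact Or.inr hx2
    exact (measure_mono hsub).trans ((measure_union_le _ _).trans (by rw [hnull, add_zero]))
  · have h : θ + (a + 2 * ε) ≤ ⨅ i, x i := le_ciInf fun i => hx i (mem_univ i)
    have h2 : ε ≤ (⨅ i, x i) - a - ε - θ := by linarith
    exact h2.trans (le_abs_self _)

lemma expRate_shiftedMin (hf : IsIntervalDensity f a b) (θ : ℝ) {ε : ℝ}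
    (h : ∫ x in Iio (a + 2 * ε), f x < 1) :
    expRate (shiftFamily f) (shiftedMin a ε) θ ε =
      ((-Real.log (1 - ∫ x in Iio (a + 2 * ε), f x) : ℝ) : EReal) := by
  rw [expRate]
  refine (liminf_congr ?_).trans (liminf_const _)
  filter_upwards [eventually_gt_atTop 0] with n hn
  rw [hf.iidLaw_shiftedMin θ ε hn.ne', ENNReal.log_pow, ENNReal.log_ofReal_of_pos (sub_pos.2 h)]
  have hn' : (n : ℝ) ≠ 0 := by positivity
  have e1 : (n : EReal) = ((n : ℝ) : EReal) := rfl
  rw [e1, ← EReal.coe_mul, ← EReal.coe_neg, ← EReal.coe_div]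
  congr 1
  field_simp

/-- By translation invariance the rate does not depend on the parameter. -/
lemma worstRate_shiftedMin (hf : IsIntervalDensity f a b) (θ : ℝ) {ε : ℝ} (hε : 0 < ε)
    (h : ∫ x in Iio (a + 2 * ε), f x < 1) :
    worstRate (shiftFamily f) (shiftedMin a ε) θ ε =
      expRate (shiftFamily f) (shiftedMin a ε) θ ε := by
  rw [worstRate]
  have hne : (Icc (θ - ε) (θ + ε)).Nonempty := ⟨θ, by constructor <;> linarith⟩
  simp_rw [hf.expRate_shiftedMin _ h]
  exact biInf_const hne

lemma tendsto_setIntegral_Iio (hf : IsIntervalDensity f a b) (hκ1 : 1 < κ)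
    (hl : LeftEndpoint f a κ A) :
    Tendsto (fun t => (∫ x in Iio (a + t), f x) / t ^ κ) (𝓝[>] 0) (𝓝 (A / κ)) := by
  rw [Metric.tendsto_nhds]
  intro η hη
  obtain ⟨c, hac, hc⟩ := mem_nhdsGT_iff_exists_Ioo_subset.1
    ((Metric.tendsto_nhds.1 hl.tendsto) η hη)
  have hac : a < c := hac
  filter_upwards [self_mem_nhdsWithin,
    mem_nhdsWithin_of_mem_nhds (Iio_mem_nhds (sub_pos.2 hac))] with t ht htc
  have ht : 0 < t := ht
  have htc : t < c - a := htc
  have hpow : IntervalIntegrable (fun u : ℝ => u ^ (κ - 1)) volume 0 t :=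
    intervalIntegral.intervalIntegrable_rpow' (by linarith)
  have hval : ∫ u in (0 : ℝ)..t, u ^ (κ - 1) = t ^ κ / κ := by
    rw [integral_rpow (Or.inl (by linarith)), sub_add_cancel, Real.zero_rpow (by linarith),
      sub_zero]
  have hF : ∫ x in Iio (a + t), f x = ∫ u in (0 : ℝ)..t, f (a + u) := by
    rw [intervalIntegral.integral_comp_add_left (fun x => f x), add_zero,
      intervalIntegral.integral_of_le (by linarith), integral_Ioc_eq_integral_Ioo]
    refine (setIntegral_eq_of_subset_of_forall_sdiff_eq_zero measurableSet_Iio Ioo_subset_Iio_self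
      fun x hx => hf.eq_zero x fun h => hx.2 ⟨h.1, hx.1⟩)
  have hfI : IntervalIntegrable (fun u => f (a + u)) volume 0 t :=
    (hf.integrable.comp_add_left a).intervalIntegrable
  have hdiff : |(∫ u in (0 : ℝ)..t, f (a + u)) - A * (t ^ κ / κ)| ≤ η * (t ^ κ / κ) := by
    rw [← hval, ← intervalIntegral.integral_const_mul,
      ← intervalIntegral.integral_const_mul,
      ← intervalIntegral.integral_sub hfI (hpow.const_mul A), ← Real.norm_eq_abs]
    refine intervalIntegral.norm_integral_le_of_norm_le ht.le (ae_of_all _ fun u hu => ?_)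
      (hpow.const_mul η)
    have h1 : dist (f (a + u) / (a + u - a) ^ (κ - 1)) A < η :=
      hc ⟨by linarith [hu.1], by linarith [hu.2]⟩
    have hup : 0 < u ^ (κ - 1) := Real.rpow_pos_of_pos hu.1 _
    rw [add_sub_cancel_left, Real.dist_eq] at h1
    have e : f (a + u) - A * u ^ (κ - 1) = (f (a + u) / u ^ (κ - 1) - A) * u ^ (κ - 1) := by
      field_simp
    rw [e, Real.norm_eq_abs, abs_mul, abs_of_pos hup]
    gcongr
  have htκ : 0 < t ^ κ := by positivity
  rw [hF, Real.dist_eq]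
  have e : (∫ u in (0 : ℝ)..t, f (a + u)) / t ^ κ - A / κ =
      ((∫ u in (0 : ℝ)..t, f (a + u)) - A * (t ^ κ / κ)) / t ^ κ := by
    field_simp
  rw [e, abs_div, abs_of_pos htκ, div_lt_iff₀ htκ]
  refine hdiff.trans_lt ?_
  -- Integrating the power produces the factor 1/κ < 1, which makes the final estimate strict.
  have : t ^ κ / κ < t ^ κ := div_lt_self htκ hκ1
  nlinarith

lemma tendsto_minExponent (hf : IsIntervalDensity f a b) (hκ1 : 1 < κ)
    (hl : LeftEndpoint f a κ A) :
    Tendsto (fun ε => ∫ x in Iio (a + 2 * ε), f x) (𝓝[>] 0) (𝓝 0) ∧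
    Tendsto (fun ε => -Real.log (1 - ∫ x in Iio (a + 2 * ε), f x) / ε ^ κ) (𝓝[>] 0)
      (𝓝 (A * 2 ^ κ / κ)) := by
  have hmap := tendsto_const_mul_nhdsGT_zero two_pos
  set F : ℝ → ℝ := fun ε => ∫ x in Iio (a + 2 * ε), f x with hF
  have h1 : Tendsto (fun ε => F ε / ε ^ κ) (𝓝[>] 0) (𝓝 (A * 2 ^ κ / κ)) := by
    have h := ((hf.tendsto_setIntegral_Iio hκ1 hl).comp hmap).mul_const (2 ^ κ)
    rw [div_mul_eq_mul_div] at h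
    refine h.congr' ?_
    filter_upwards [self_mem_nhdsWithin] with ε hε
    have hε : (0 : ℝ) < ε := hε
    simp only [Function.comp, hF]
    rw [Real.mul_rpow (by norm_num) hε.le]
    field_simp
  have h0 : Tendsto F (𝓝[>] 0) (𝓝 0) := by
    have h := h1.mul (tendsto_rpow_nhdsGT_zero (p := κ) (by linarith))
    rw [mul_zero] at h
    refine h.congr' ?_
    filter_upwards [self_mem_nhdsWithin] with ε hε
    have hε : (0 : ℝ) < ε ^ κ := Real.rpow_pos_of_pos hε κ
    field_simp
  refine ⟨h0, ?_⟩
  have h2 : Tendsto (fun ε => F ε / ε ^ κ * (1 - F ε)⁻¹) (𝓝[>] 0) (𝓝 (A * 2 ^ κ / κ)) := by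
    have h := h1.mul ((h0.const_sub 1).inv₀ (by norm_num))
    simpa using h
  -- Squeeze by F ≤ -log(1 - F) ≤ F/(1 - F).
  refine tendsto_of_tendsto_of_tendsto_of_le_of_le' h1 h2 ?_ ?_
  · filter_upwards [self_mem_nhdsWithin, h0.eventually (gt_mem_nhds one_pos)] with ε hε hd
    have hε : (0 : ℝ) < ε ^ κ := Real.rpow_pos_of_pos hε κ
    have := Real.log_le_sub_one_of_pos (sub_pos.2 hd)
    gcongr
    linarith
  · filter_upwards [self_mem_nhdsWithin, h0.eventually (gt_mem_nhds one_pos)] with ε hε hd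
    have hε : (0 : ℝ) < ε ^ κ := Real.rpow_pos_of_pos hε κ
    have hd' := sub_pos.2 hd
    have := Real.one_sub_inv_le_log_of_pos hd'
    have e : F ε / ε ^ κ * (1 - F ε)⁻¹ = ((1 - F ε)⁻¹ - 1) / ε ^ κ := by
      field_simp; ring
    rw [e]
    gcongr
    linarith

lemma tendsto_expRate_shiftedMin (hf : IsIntervalDensity f a b) (hκ1 : 1 < κ)
    (hl : LeftEndpoint f a κ A) (θ : ℝ) :
    Tendsto (fun ε : ℝ => expRate (shiftFamily f) (shiftedMin a ε) θ ε / ((|ε| ^ κ : ℝ) : EReal))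
      (𝓝[>] 0) (𝓝 ((A * 2 ^ κ / κ : ℝ) : EReal)) := by
  obtain ⟨h0, h1⟩ := hf.tendsto_minExponent hκ1 hl
  refine ((continuous_coe_real_ereal.tendsto _).comp h1).congr' ?_
  filter_upwards [self_mem_nhdsWithin, h0.eventually (gt_mem_nhds one_pos)] with ε hε hd
  rw [hf.expRate_shiftedMin θ hd, abs_of_pos hε, ← EReal.coe_div]
  rfl

lemma tendsto_worstRate_shiftedMin (hf : IsIntervalDensity f a b) (hκ1 : 1 < κ)
    (hl : LeftEndpoint f a κ A) (θ : ℝ) :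
    Tendsto (fun ε : ℝ => worstRate (shiftFamily f) (shiftedMin a ε) θ ε / ((|ε| ^ κ : ℝ) : EReal))
      (𝓝[>] 0) (𝓝 ((A * 2 ^ κ / κ : ℝ) : EReal)) := by
  refine (hf.tendsto_expRate_shiftedMin hκ1 hl θ).congr' ?_
  filter_upwards [self_mem_nhdsWithin,
    (hf.tendsto_minExponent hκ1 hl).1.eventually (gt_mem_nhds one_pos)] with ε hε hd
  rw [hf.worstRate_shiftedMin θ hε hd]

/-! ### The upper bound on α₁ and the conclusion -/

lemma eventually_iSup_worstRate_le (hf : IsIntervalDensity f a b) (hκ1 : 1 < κ) (hκ : κ < 2)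
    (hA : 0 < A) (ht : 1 ≤ thresholdFun (2 - κ)) (hl : LeftEndpoint f a κ A)
    (hr : NegligibleRightEndpoint f b κ) (θ : ℝ) {ρ : ℝ} (hρ : A / κ < ρ) :
    ∀ᶠ ε in 𝓝[>] (0 : ℝ), ⨆ T : Estimator, worstRate (shiftFamily f) T θ ε ≤
      ((ρ * 2 ^ κ * ε ^ κ : ℝ) : EReal) := by
  have ht' : 1 ≤ thresholdFun (1 - (κ - 1)) := by rwa [show 1 - (κ - 1) = 2 - κ by ring]
  set M := A / κ with hM
  have hM0 : 0 < M := div_pos hA (by linarith)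
  have hup : ∀ s ∈ Ioo (0 : ℝ) 1, A * powerRate (κ - 1) s ≤ M := fun s hs => by
    have := powerRate_le (by linarith) (by linarith) ht' hs
    rw [show 1 + (κ - 1) = κ by ring] at this
    calc _ ≤ A * (1 / κ) := by gcongr
      _ = _ := by rw [hM]; ring
  have hlow : ∀ s ∈ Ioo (0 : ℝ) 1, s * M ≤ A * powerRate (κ - 1) s := fun s hs => by
    have := le_powerRate (α := κ - 1) (by linarith) (by linarith) hs
    rw [show 1 + (κ - 1) = κ by ring] at this
    calc s * M = A * (s * (1 / κ)) := by rw [hM]; ring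
      _ ≤ _ := by gcongr
  -- Every normalized rate of order r lies between rM and M. The orders 1 - η, 1 - η², 1 - η³
  -- approach 1 at separate scales, so that the errors from these bounds, η²M for the lower order
  -- and about η³M for the upper one, stay below the gains (ρ - M)(1 - η) and (ρ - M)(η² - η³).
  obtain ⟨η, hη0, hη1, hηM⟩ : ∃ η : ℝ, 0 < η ∧ η ≤ 1 / 2 ∧ η * M < (ρ - M) / 2 := by
    refine ⟨min (1 / 2) ((ρ - M) / (4 * M)), lt_min (by norm_num)
      (div_pos (sub_pos.2 hρ) (by positivity)), min_le_left _ _, ?_⟩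
    calc _ ≤ (ρ - M) / (4 * M) * M := by gcongr; exact min_le_right _ _
      _ = (ρ - M) / 4 := by field_simp
      _ < _ := by linarith
  have hη2 : η ^ 2 < η := by nlinarith
  have hη3 : η ^ 3 < η ^ 2 := by nlinarith [pow_pos hη0 2]
  have hη3' : 0 < η ^ 3 := by positivity
  set s := 1 - η ^ 2 with hs
  set s₁ := 1 - η with hs₁
  set s₂ := 1 - η ^ 3 with hs₂
  have hsm : s ∈ Ioo (0 : ℝ) 1 := by constructor <;> linarith
  have hsm₁ : s₁ ∈ Ioo (0 : ℝ) 1 := by constructor <;> linarith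
  have hsm₂ : s₂ ∈ Ioo (0 : ℝ) 1 := by constructor <;> linarith
  have hl' : (1 - s) / (1 - s₁) = η := by
    rw [hs, hs₁, sub_sub_cancel, sub_sub_cancel, sq, mul_div_cancel_right₀ _ hη0.ne']
  have key1 : A * powerRate (κ - 1) s < ρ * (1 - (1 - s) / (1 - s₁)) +
      (1 - s) / (1 - s₁) * (A * powerRate (κ - 1) s₁) := by
    rw [hl']
    have h1 := hup s hsm
    have h2 := mul_le_mul_of_nonneg_left (hlow s₁ hsm₁) hη0.le
    rw [hs₁] at h2
    nlinarith
  have key2 : A * powerRate (κ - 1) s < ρ * (1 - s / s₂) +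
      s / s₂ * (A * powerRate (κ - 1) s₂) := by
    have h1 := hup s hsm
    have h2 := mul_le_mul_of_nonneg_left (hlow s₂ hsm₂) (div_nonneg hsm.1.le hsm₂.1.le)
    have e : s / s₂ * (s₂ * M) = s * M := by
      have := hsm₂.1.ne'
      field_simp
    rw [e] at h2
    have h3 : 1 - s / s₂ = (η ^ 2 - η ^ 3) / s₂ := by
      have := hsm₂.1.ne'
      field_simp
      rw [hs, hs₂]; ring
    have h4 : η ^ 2 - η ^ 3 ≤ 1 - s / s₂ := by
      rw [h3, le_div_iff₀ hsm₂.1]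
      nlinarith [hsm₂.2]
    have h5 : (ρ - M) * (η ^ 2 - η ^ 3) ≤ (ρ - M) * (1 - s / s₂) :=
      mul_le_mul_of_nonneg_left h4 (sub_pos.2 hρ).le
    have h6 : 0 < s / s₂ := div_pos hsm.1 hsm₂.1
    have h7 : M * (1 - s / s₂) + s * M = M - (s / s₂ - s) * M := by ring
    have h8 : s / s₂ - s ≤ η ^ 3 := by
      have e8 : s / s₂ - s = s / s₂ * η ^ 3 := by
        have := hsm₂.1.ne'
        field_simp
        rw [hs₂]; ring
      rw [e8]
      have : s / s₂ ≤ 1 := by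
        rw [div_le_one hsm₂.1]; linarith
      nlinarith
    have h9 : (s / s₂ - s) * M ≤ η ^ 3 * M := by gcongr
    have h10 : η ^ 3 * M < (ρ - M) * (η ^ 2 - η ^ 3) := by
      have : η ^ 2 * (η * M) < η ^ 2 * ((ρ - M) / 2) := by gcongr
      have h11 : η ^ 2 * ((ρ - M) / 2) ≤ (ρ - M) * (η ^ 2 - η ^ 3) := by
        have : 0 ≤ (ρ - M) * η ^ 2 * (1 / 2 - η) :=
          mul_nonneg (mul_nonneg (sub_pos.2 hρ).le (by positivity)) (by linarith)
        nlinarith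
      nlinarith
    nlinarith
  -- The two hypotheses are 2ε apart, so the strict inequalities between limits are used at
  -- separation 2ε; this produces the factor 2^κ.
  have hmap := tendsto_const_mul_nhdsGT_zero two_pos
  have hS := fun {r : ℝ} (h : r ∈ Ioo (0 : ℝ) 1) =>
    hf.tendsto_shiftEntropy_div hκ1 hκ hA ht hl hr h
  have ev1 := hmap.eventually ((hS hsm).eventually_lt
    (((hS hsm₁).const_mul _).const_add _) key1)
  have ev2 := hmap.eventually ((hS hsm).eventually_lt
    (((hS hsm₂).const_mul _).const_add _) key2)
  have ev3 := hmap.eventually (eventually_prod_principal_iff.1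
    ((hf.tendsto_deficit hκ1 hκ hA ht hl hr).eventually (gt_mem_nhds one_pos)))
  filter_upwards [ev1, ev2, ev3, self_mem_nhdsWithin] with ε h1 h2 h3 hε
  have hε : 0 < ε := hε
  have hp : (0 : ℝ) < (2 * ε) ^ κ := by positivity
  have h1s : s₁ < s := by linarith
  have hs2 : s < s₂ := by linarith
  refine iSup_le fun T => hf.worstRate_le hε hsm hsm₁ hsm₂ h1s hs2 (h3 s hsm) (h3 s₁ hsm₁)
    (h3 s₂ hsm₂) ?_ ?_ T
  · rw [div_lt_iff₀ hp] at h1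
    rw [mul_assoc ρ, ← Real.mul_rpow (by norm_num) hε.le]
    refine h1.trans_eq ?_
    field_simp
  · rw [div_lt_iff₀ hp] at h2
    rw [mul_assoc ρ, ← Real.mul_rpow (by norm_num) hε.le]
    refine h2.trans_eq ?_
    field_simp

lemma alphaOne_eq (hf : IsIntervalDensity f a b) (hκ1 : 1 < κ) (hκ : κ < 2)
    (hA : 0 < A) (ht : 1 ≤ thresholdFun (2 - κ)) (hl : LeftEndpoint f a κ A)
    (hr : NegligibleRightEndpoint f b κ) (θ : ℝ) :
    alphaOne (shiftFamily f) (fun x => |x| ^ κ) θ = ((A * 2 ^ κ / κ : ℝ) : EReal) := by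
  rw [alphaOne]
  refine le_antisymm ?_ ?_
  · refine EReal.le_of_forall_lt_iff_le.1 fun z hz => ?_
    rw [EReal.coe_lt_coe_iff] at hz
    have h2 : (0 : ℝ) < 2 ^ κ := by positivity
    have hρ : A / κ < z / 2 ^ κ := by
      rw [lt_div_iff₀ h2]
      calc _ = A * 2 ^ κ / κ := by ring
        _ < z := hz
    refine limsup_le_of_le (by isBoundedDefault) ?_
    filter_upwards [hf.eventually_iSup_worstRate_le hκ1 hκ hA ht hl hr θ hρ, self_mem_nhdsWithin]
      with ε h hε
    have hε : 0 < ε := hε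
    have hεκ : 0 < ε ^ κ := by positivity
    rw [abs_of_pos hε, EReal.div_le_iff_le_mul (by exact_mod_cast hεκ) (EReal.coe_ne_top _),
      ← EReal.coe_mul]
    refine h.trans_eq ?_
    congr 1
    field_simp
  · rw [← (hf.tendsto_worstRate_shiftedMin hκ1 hl θ).limsup_eq]
    refine limsup_le_limsup ?_
    filter_upwards [self_mem_nhdsWithin] with ε hε
    have hε : 0 < ε := hε
    exact EReal.div_le_div_right_of_nonneg (by exact_mod_cast (by positivity : 0 ≤ |ε| ^ κ))
      (le_iSup (fun T => worstRate (shiftFamily f) T θ ε) (shiftedMin a ε))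

end IsIntervalDensity

lemma hasIndex_abs_rpow (κ : ℝ) : HasIndex (fun x => |x| ^ κ) κ := by
  intro x hx
  refine tendsto_const_nhds.congr' ?_
  filter_upwards [self_mem_nhdsWithin] with ε hε
  have hε : (0 : ℝ) < ε := hε
  have : ε ^ κ ≠ 0 := by positivity
  rw [abs_mul, abs_of_pos hx, abs_of_pos hε, Real.mul_rpow hx.le hε.le]
  field_simp

end LargeDeviation

theorem mainTheorem9 :
    ∃ t₀ : ℝ,
      (t₀ ∈ Ioo (0 : ℝ) (1 / 2) ∧
        2 * t₀ + t₀ * (1 - t₀) * (psi (1 + t₀) - psi 1) = 1) ∧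
      (∀ t ∈ Ioo (0 : ℝ) (1 / 2),
        2 * t + t * (1 - t) * (psi (1 + t) - psi 1) = 1 → t = t₀) ∧
      |t₀ - 0.4326| < 0.0001 ∧
      ∀ (f : ℝ → ℝ) (a : ℝ) (b : EReal) (κ A₁ : ℝ),
        1 < κ → κ < 2 - t₀ → 0 < A₁ →
        IsIntervalDensity f a b →
        LeftEndpoint f a κ A₁ →
        NegligibleRightEndpoint f b κ →
        HasIndex (fun x => |x| ^ κ) κ ∧
        ∀ θ : ℝ,
          UniformRenyiLimit (shiftFamily f) (fun x => |x| ^ κ) θ ∧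
          alphaOne (shiftFamily f) (fun x => |x| ^ κ) θ =
            alphaOneBar (shiftFamily f) (fun x => |x| ^ κ) κ θ ∧
          alphaOneBar (shiftFamily f) (fun x => |x| ^ κ) κ θ =
            ((A₁ * 2 ^ κ / κ : ℝ) : EReal) ∧
          Tendsto (fun ε : ℝ =>
              expRate (shiftFamily f) (shiftedMin a ε) θ ε / ((|ε| ^ κ : ℝ) : EReal))
            (𝓝[>] 0) (𝓝 ((A₁ * 2 ^ κ / κ : ℝ) : EReal)) ∧
          Tendsto (fun ε : ℝ =>
              worstRate (shiftFamily f) (shiftedMin a ε) θ ε / ((|ε| ^ κ : ℝ) : EReal))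
            (𝓝[>] 0) (𝓝 ((A₁ * 2 ^ κ / κ : ℝ) : EReal)) := by
  obtain ⟨t₀, ht₀, hF⟩ := exists_threshold
  have ht₀' : t₀ ∈ Ioo (0 : ℝ) (1 / 2) :=
    ⟨lt_trans (by norm_num) ht₀.1, ht₀.2.trans (by norm_num)⟩
  refine ⟨t₀, ⟨ht₀', hF⟩, fun t ht h => ?_, ?_, ?_⟩
  · exact thresholdFun_strictMonoOn.injOn (Ioo_subset_Icc_self ht) (Ioo_subset_Icc_self ht₀')
      (Eq.trans h hF.symm)
  · rw [abs_lt]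
    constructor <;> linarith [ht₀.1, ht₀.2]
  · intro f a b κ A₁ hκ1 hκ hA hf hl hr
    have hκ2 : κ < 2 := by linarith [ht₀'.1]
    -- The hypotheses on κ place 2 - κ strictly between t₀ and 1.
    have ht := one_le_thresholdFun ht₀' hF (t := 2 - κ) (by linarith) (by linarith)
    refine ⟨hasIndex_abs_rpow κ, fun θ => ⟨⟨fun s => A₁ * powerRate (κ - 1) s, fun η hη =>
      hf.uniformRenyi hκ1 hκ2 hA ht hl hr θ hη⟩, ?_, hf.alphaOneBar_eq hκ1 hκ2 hA ht hl hr θ,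
      hf.tendsto_expRate_shiftedMin hκ1 hl θ, hf.tendsto_worstRate_shiftedMin hκ1 hl θ⟩⟩
    rw [hf.alphaOne_eq hκ1 hκ2 hA ht hl hr θ, hf.alphaOneBar_eq hκ1 hκ2 hA ht hl hr θ]
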